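/- Let $M^n$ be a nonempty complete Riemannian manifold and let $f:M^n\to\mathbb{H}^m$ be an isometric immersion into the hyperbolic space of constant sectional curvature $-1$. Let $\alpha$ be the second fundamental form of $f$. For $x\in M^n$ let $\Delta(x)=\{X\in T_xM:\alpha(X,Y)=0 \text{ for all } Y\in T_xM\}$ be the relative nullity subspace of $f$ at $x$, let $\nu(x)=\dim\Delta(x)$, and put $\nu_0=\min_{x\in M}\nu(x)$ and $\nu_0^\perp=n-\nu_0$. If $$\nu_0\ \ge\ \frac{\nu_0^\perp(\nu_0^\perp+1)}{2},$$ then the second fundamental form of $f$ is not bounded away from zero: there is no constant $c>0$ such that $\|\alpha_x\|\ge c$ for all $x\in M^n$, where $\|\alpha_x\|^2=\sum_{i,j=1}^n\|\alpha(e_i,e_j)\|^2$ for an orthonormal basis $e_1,\dots,e_n$ of $T_xM$. -/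

import Mathlib

open scoped Manifold ContDiff
open Bundle

noncomputable section

/-- The vector space underlying Lorentz-Minkowski space `ℝ^{1,m}`; the first factor is the time
coordinate. The (sup) norm that this product carries is used only for its smooth structure. -/
abbrev LorentzSpace (m : ℕ) : Type := ℝ × EuclideanSpace ℝ (Fin m)

/-- The Lorentz form `⟨p, q⟩ = -p₀ q₀ + p₁ q₁ + ⋯ + pₘ qₘ`. -/
def lorentzForm (m : ℕ) : LinearMap.BilinForm ℝ (LorentzSpace m) :=
  LinearMap.mk₂ ℝ (fun p q => -(p.1 * q.1) + inner ℝ p.2 q.2)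
    (fun p p' q => by simp only [Prod.fst_add, Prod.snd_add, inner_add_left]; ring)
    (fun c p q => by
      simp only [Prod.smul_fst, Prod.smul_snd, real_inner_smul_left, smul_eq_mul]; ring)
    (fun p q q' => by simp only [Prod.fst_add, Prod.snd_add, inner_add_right]; ring)
    (fun c p q => by
      simp only [Prod.smul_fst, Prod.smul_snd, real_inner_smul_right, smul_eq_mul]; ring)

/-- Hyperbolic space `ℍ^m` of constant sectional curvature `-1` (hyperboloid model): the upper
sheet of `⟨p, p⟩ = -1`. Its tangent space at `p` is the Lorentz-orthogonal complement of `p`, with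
the restriction of the Lorentz form, which is positive definite there, as Riemannian metric. -/
abbrev HyperbolicSpace (m : ℕ) : Type :=
  {p : LorentzSpace m // lorentzForm m p p = -1 ∧ 0 < p.1}

section Submanifold

variable (n : ℕ) {m : ℕ} {M : Type*} [EMetricSpace M] [ChartedSpace (EuclideanSpace ℝ (Fin n)) M]

/-- The map `f`, viewed as a map into Lorentz space. -/
def ambientMap (f : M → HyperbolicSpace m) : M → LorentzSpace m := fun x => (f x).1

/-- The differential `f_* : T_x M → T_{f x} ℍ^m ⊆ ℝ^{1,m}`. -/
def pushforward (f : M → HyperbolicSpace m) (x : M) :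
    TangentSpace (𝓡 n) x →ₗ[ℝ] LorentzSpace m :=
  (mfderiv (𝓡 n) 𝓘(ℝ, LorentzSpace m) (ambientMap f) x).toLinearMap

/-- The flat derivative `D_u (f_* V)` at `x` in Lorentz space, where `V` is the vector field near
`x` with `V x = v` and constant coefficients in the preferred chart at `x` (the chart through which
Mathlib identifies `T_x M` with `ℝⁿ`): the second derivative at `x` of `f` read in that chart. -/
def flatDerivative (f : M → HyperbolicSpace m) (x : M) :
    TangentSpace (𝓡 n) x →ₗ[ℝ] TangentSpace (𝓡 n) x →ₗ[ℝ] LorentzSpace m :=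
  let B : EuclideanSpace ℝ (Fin n) →L[ℝ] EuclideanSpace ℝ (Fin n) →L[ℝ] LorentzSpace m :=
    fderiv ℝ (fderiv ℝ (ambientMap f ∘ (extChartAt (𝓡 n) x).symm)) (extChartAt (𝓡 n) x x)
  LinearMap.mk₂ ℝ (fun u v : TangentSpace (𝓡 n) x => B u v)
    (fun u u' v => B.map_add₂ u u' v) (fun c u v => B.map_smul₂ c u v)
    (fun u v v' => (B u).map_add v v') (fun c u v => (B u).map_smul c v)

/-- The orthogonal projection of `ℝ^{1,m}` onto `T_p ℍ^m`, for `p` on the hyperboloid: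
`w ↦ w + ⟨w, p⟩ p`. Composed with the flat derivative it gives the Levi-Civita connection of
`ℍ^m`. -/
def tangentProjection (p : HyperbolicSpace m) : LorentzSpace m →ₗ[ℝ] LorentzSpace m :=
  LinearMap.id + ((lorentzForm m).flip p.1).smulRight p.1

/-- The second derivative `∇̃_u (f_* V)` at `x`, where `∇̃` is the Levi-Civita connection of `ℍ^m`
and `V` is as in `flatDerivative`. -/
def ambientCovariantDerivative (f : M → HyperbolicSpace m) (x : M) :
    TangentSpace (𝓡 n) x →ₗ[ℝ] TangentSpace (𝓡 n) x →ₗ[ℝ] LorentzSpace m :=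
  (flatDerivative n f x).compr₂ (tangentProjection (f x))

variable [RiemannianBundle (fun x : M => TangentSpace (𝓡 n) x)]

/-- `f` is an isometric immersion: it is smooth as a map into Lorentz space (equivalently, into the
embedded submanifold `ℍ^m`), and its differential preserves inner products. -/
structure IsIsometricImmersion (f : M → HyperbolicSpace m) : Prop where
  smooth : ContMDiff (𝓡 n) 𝓘(ℝ, LorentzSpace m) ∞ (ambientMap f)
  isometric : ∀ (x : M) (u v : TangentSpace (𝓡 n) x),
    lorentzForm m (pushforward n f x u) (pushforward n f x v) = inner ℝ u v

instance (x : M) : FiniteDimensional ℝ (TangentSpace (𝓡 n) x) :=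
  inferInstanceAs (FiniteDimensional ℝ (EuclideanSpace ℝ (Fin n)))

/-- An orthonormal basis of `T_x M` for the Riemannian metric. -/
def tangentONB (x : M) :
    OrthonormalBasis (Fin (Module.finrank ℝ (TangentSpace (𝓡 n) x))) ℝ (TangentSpace (𝓡 n) x) :=
  stdOrthonormalBasis ℝ (TangentSpace (𝓡 n) x)

/-- On `T_{f x} ℍ^m`, the orthogonal projection onto the normal space of `f` at `x`, that is, onto
the orthogonal complement of `f_* T_x M`: `w ↦ w - ∑ ⟨w, f_* eᵢ⟩ f_* eᵢ`. -/
def normalProjection (f : M → HyperbolicSpace m) (x : M) :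
    LorentzSpace m →ₗ[ℝ] LorentzSpace m :=
  LinearMap.id - ∑ i, ((lorentzForm m).flip (pushforward n f x (tangentONB n x i))).smulRight
    (pushforward n f x (tangentONB n x i))

/-- The second fundamental form `α(u, v) = (∇̃_u f_* V)^⊥` of `f` at `x`. -/
def secondFundamentalForm (f : M → HyperbolicSpace m) (x : M) :
    TangentSpace (𝓡 n) x →ₗ[ℝ] TangentSpace (𝓡 n) x →ₗ[ℝ] LorentzSpace m :=
  (ambientCovariantDerivative n f x).compr₂ (normalProjection n f x)

/-- `‖α_x‖ = (∑ ‖α(eᵢ, eⱼ)‖²)^{1/2}` for an orthonormal basis `eᵢ` of `T_x M`. -/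
def secondFundamentalFormNorm (f : M → HyperbolicSpace m) (x : M) : ℝ :=
  Real.sqrt (∑ i, ∑ j,
    lorentzForm m (secondFundamentalForm n f x (tangentONB n x i) (tangentONB n x j))
      (secondFundamentalForm n f x (tangentONB n x i) (tangentONB n x j)))

/-- The extrinsic geometry of `f` (its second fundamental form) is bounded away from zero. -/
def ExtrinsicGeometryBoundedAwayFromZero (f : M → HyperbolicSpace m) : Prop :=
  ∃ c : ℝ, 0 < c ∧ ∀ x : M, c ≤ secondFundamentalFormNorm n f x

/-- The relative nullity subspace `Δ(x) = {u | α(u, v) = 0 for all v}` of `f` at `x`. -/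
def relativeNullity (f : M → HyperbolicSpace m) (x : M) : Submodule ℝ (TangentSpace (𝓡 n) x) :=
  LinearMap.ker (secondFundamentalForm n f x)

/-- The index of relative nullity `ν(x) = dim Δ(x)`. -/
def nullityIndex (f : M → HyperbolicSpace m) (x : M) : ℕ :=
  Module.finrank ℝ (relativeNullity n f x)

/-- The minimum index of relative nullity `ν₀ = min_x ν(x)`. -/
def minNullityIndex (f : M → HyperbolicSpace m) : ℕ :=
  sInf (Set.range (nullityIndex n f))

end Submanifold

end

/-! View f as a map g into Lorentz space. Let G(x) be the orthogonal projection onto the span of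
g(x) and the tangent space, and R(x) the one onto the conullity, the complement of Δ(x) in the
tangent space. The derivative of G is the second fundamental form α; the derivative of R, applied to
T in Δ, is the splitting tensor C_T h = -(∇_h T)^{Δ⊥} = DR[h] T. Since G and R take values in a
fixed space of operators, the Codazzi and structure equations become statements about ordinary
derivatives.

On the open set where ν is minimal, G and R are constant along Δ (`dR_eq_zero`), so the leaves of Δ
are pieces of hyperbolic subspaces. Along a leaf geodesic from x with unit velocity v, the fields
J_h(t) = cosh t · h - sinh t · C_v h carry α along: α(J_h(t), ·) at time t equals α(h, ·) at x
(`exists_leaf_curve`). Hence the rank of α cannot drop at a limit point of a leaf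
(`sameLeaf_of_tendsto`), and completeness of M yields points of the geodesic at arbitrarily large
times (`exists_sameLeaf_far`).

Let k = ν₀^⊥. Quadratic forms on the conullity at x form a space of dimension k(k+1)/2 ≤ ν₀, so the
linear map sending u in Δ(x) to the form h ↦ ⟨-C_u h, h⟩ either has a kernel or is onto. Either way
some u ≠ 0 satisfies ⟨-C_u h, h⟩ = a|h|² with a ≥ 0 (`exists_quadratic_eq_smul`). In the direction
of u this gives |J_h(t)| ≥ cosh t · |h|, while α(J_h(t), ·) does not change, so ‖α‖ decays like 1 /
cosh t (`exists_shape_decay`) and has no positive lower bound. -/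

/-! ### Local equations of the relative nullity in a chart. -/

section Chart

variable {X L : Type*} [NormedAddCommGroup X] [NormedSpace ℝ X]
  [NormedAddCommGroup L] [NormedSpace ℝ L]

theorem minSmoothness_two_le_infty : minSmoothness ℝ 2 ≤ (∞ : WithTop ℕ∞) := by
  rw [minSmoothness_of_isRCLikeNormedField]; norm_cast

/-- The derivative of a family of operators applied to a family of vectors. -/
theorem fderiv_clm_apply_apply {W W' : Type*} [NormedAddCommGroup W] [NormedSpace ℝ W]
    [NormedAddCommGroup W'] [NormedSpace ℝ W'] {P : X → W →L[ℝ] W'} {Y : X → W} {x : X}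
    (hP : DifferentiableAt ℝ P x) (hY : DifferentiableAt ℝ Y x) (u : X) :
    fderiv ℝ (fun y => P y (Y y)) x u = P x (fderiv ℝ Y x u) + fderiv ℝ P x u (Y x) := by
  rw [fderiv_clm_apply hP hY]; simp

theorem fderiv_clm_apply_const_apply {W W' : Type*} [NormedAddCommGroup W] [NormedSpace ℝ W]
    [NormedAddCommGroup W'] [NormedSpace ℝ W'] {P : X → W →L[ℝ] W'} {x : X}
    (hP : DifferentiableAt ℝ P x) (w : W) (u : X) :
    fderiv ℝ (fun y => P y w) x u = fderiv ℝ P x u w := by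
  rw [fderiv_clm_apply_apply hP (differentiableAt_const w)]; simp

theorem form_fderiv_eq_zero {B : L →L[ℝ] L →L[ℝ] ℝ} (hs : ∀ p q, B p q = B q p) {O : Set X}
    (hO : IsOpen O) {g : X → L} (hg : ∀ x ∈ O, DifferentiableAt ℝ g x) {c : ℝ}
    (h : ∀ x ∈ O, B (g x) (g x) = c) {x : X} (hx : x ∈ O) (u : X) :
    B (fderiv ℝ g x u) (g x) = 0 := by
  have h1 : fderiv ℝ (fun y => B (g y) (g y)) x u = 0 := by
    have := Filter.EventuallyEq.fderiv_eq (𝕜 := ℝ) (f₁ := fun y => B (g y) (g y)) (f := fun _ => c)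
      (Filter.eventually_of_mem (hO.mem_nhds hx) h)
    rw [this]; simp
  have hB : DifferentiableAt ℝ (fun y => B (g y)) x := B.differentiableAt.comp x (hg x hx)
  have hB' : fderiv ℝ (fun y => B (g y)) x u = B (fderiv ℝ g x u) := by
    have := fderiv_comp x B.differentiableAt (hg x hx)
    rw [ContinuousLinearMap.fderiv] at this
    exact DFunLike.congr_fun this u
  rw [fderiv_clm_apply_apply hB (hg x hx), hB', hs (g x)] at h1
  linarith

/-- Let `B` be a nondegenerate symmetric form. If `P'` is a self-adjoint tangent vector at `P` to
the set of self-adjoint idempotents and `P'` vanishes on the range of `P`, then `P' = 0`. -/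
theorem eq_zero_of_comp_eq_zero {B : L →L[ℝ] L →L[ℝ] ℝ}
    (hnd : ∀ p, (∀ q, B p q = 0) → p = 0) {P P' : L →L[ℝ] L}
    (hP : ∀ p q, B (P p) q = B p (P q)) (hP' : ∀ p q, B (P' p) q = B p (P' q))
    (h : ∀ w, P' w = P (P' w) + P' (P w)) (h0 : ∀ w, P' (P w) = 0) (w : L) : P' w = 0 := by
  -- P P' is the B-adjoint of P' P, so it vanishes together with it.
  have h1 : ∀ w, P (P' w) = 0 := fun w => hnd _ fun q => by
    rw [hP, hP', h0]; simp
  rw [h, h0, h1, add_zero]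

/-- The extrinsic data of a submanifold `g` of the hyperboloid `B(p, p) = -1`, read in a chart:
`G` is the orthogonal projection onto the span of `g` and of the tangent space, and `S` is the
tangential projection followed by the inverse of the differential. -/
structure HullChart (B : L →L[ℝ] L →L[ℝ] ℝ) (O : Set X) (g : X → L) (G : X → L →L[ℝ] L)
    (S : X → L →L[ℝ] X) : Prop where
  isOpen : IsOpen O
  symm : ∀ p q, B p q = B q p
  nondeg : ∀ p, (∀ q, B p q = 0) → p = 0
  g_smooth : ∀ x ∈ O, ContDiffAt ℝ ∞ g x
  G_smooth : ∀ x ∈ O, ContDiffAt ℝ ∞ G x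
  S_smooth : ∀ x ∈ O, ContDiffAt ℝ ∞ S x
  form_g : ∀ x ∈ O, B (g x) (g x) = -1
  S_dg : ∀ x ∈ O, ∀ u, S x (fderiv ℝ g x u) = u
  S_g : ∀ x ∈ O, S x (g x) = 0
  dg_S : ∀ x ∈ O, ∀ w, fderiv ℝ g x (S x w) = G x w + B w (g x) • g x
  G_idem : ∀ x ∈ O, ∀ w, G x (G x w) = G x w
  G_adj : ∀ x ∈ O, ∀ p q, B (G x p) q = B p (G x q)

/-- A `HullChart` in which the orthogonal projection `R` onto the complement of the relative nullity
in the tangent space is smooth. -/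
structure NullityChart (B : L →L[ℝ] L →L[ℝ] ℝ) (O : Set X) (g : X → L) (G R : X → L →L[ℝ] L)
    (S : X → L →L[ℝ] X) : Prop extends HullChart B O g G S where
  R_smooth : ∀ x ∈ O, ContDiffAt ℝ ∞ R x
  R_idem : ∀ x ∈ O, ∀ w, R x (R x w) = R x w
  R_adj : ∀ x ∈ O, ∀ p q, B (R x p) q = B p (R x q)
  R_ker : ∀ x ∈ O, ∀ w, R x w = 0 ↔ fderiv ℝ G x (S x w) = 0

namespace HullChart

variable {B : L →L[ℝ] L →L[ℝ] ℝ} {O : Set X} {g : X → L} {G : X → L →L[ℝ] L}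
  {S : X → L →L[ℝ] X} (H : HullChart B O g G S) {x : X} (hx : x ∈ O)
include H

theorem fderiv_congr {W : Type*} [NormedAddCommGroup W] [NormedSpace ℝ W] {F F' : X → W}
    (h : ∀ y ∈ O, F y = F' y) {x : X} (hx : x ∈ O) : fderiv ℝ F x = fderiv ℝ F' x :=
  Filter.EventuallyEq.fderiv_eq (Filter.eventually_of_mem (H.isOpen.mem_nhds hx) h)

include hx

theorem g_diff : DifferentiableAt ℝ g x := (H.g_smooth x hx).differentiableAt (by simp)
theorem G_diff : DifferentiableAt ℝ G x := (H.G_smooth x hx).differentiableAt (by simp)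
theorem S_diff : DifferentiableAt ℝ S x := (H.S_smooth x hx).differentiableAt (by simp)
theorem dg_diff : DifferentiableAt ℝ (fderiv ℝ g) x :=
  ((H.g_smooth x hx).fderiv_right (m := 1) (by norm_cast)).differentiableAt (by simp)
theorem dG_diff : DifferentiableAt ℝ (fderiv ℝ G) x :=
  ((H.G_smooth x hx).fderiv_right (m := 1) (by norm_cast)).differentiableAt (by simp)

theorem form_dg (u : X) : B (fderiv ℝ g x u) (g x) = 0 :=
  form_fderiv_eq_zero H.symm H.isOpen (fun _ hy => H.g_diff hy) H.form_g hx u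

theorem G_dg (u : X) : G x (fderiv ℝ g x u) = fderiv ℝ g x u := by
  have := H.dg_S x hx (fderiv ℝ g x u)
  rw [H.S_dg x hx, H.form_dg hx, zero_smul, add_zero] at this
  exact this.symm

theorem G_g : G x (g x) = g x := by
  have := H.dg_S x hx (g x)
  rw [H.S_g x hx, H.form_g x hx, map_zero, neg_one_smul] at this
  exact (eq_of_sub_eq_zero (by rw [sub_eq_add_neg]; exact this.symm))

theorem S_G (w : L) : S x (G x w) = S x w := by
  have h := H.dg_S x hx (w - G x w)
  have h2 : B (w - G x w) (g x) = 0 := by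
    rw [map_sub, sub_apply, H.G_adj x hx, H.G_g hx, sub_self]
  rw [map_sub (G x), H.G_idem x hx, sub_self, h2, zero_smul, add_zero] at h
  have h3 := H.S_dg x hx (S x (w - G x w))
  rw [h, map_zero, map_sub] at h3
  exact (sub_eq_zero.1 h3.symm).symm

theorem dG_g (u : X) : fderiv ℝ G x u (g x) = 0 := by
  have h := congrArg (· u) (H.fderiv_congr (F := fun y => G y (g y)) (F' := g)
    (fun y hy => H.G_g hy) hx)
  simp only [fderiv_clm_apply_apply (H.G_diff hx) (H.g_diff hx), H.G_dg hx] at h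
  simpa using h

/-- Obtained by differentiating G(dg z) = dg z. The right-hand side is the normal part of the second
derivative of g, so the derivative of G is the second fundamental form. -/
theorem dG_dg (u z : X) : fderiv ℝ G x u (fderiv ℝ g x z) =
    fderiv ℝ (fderiv ℝ g) x u z - G x (fderiv ℝ (fderiv ℝ g) x u z) := by
  have h := congrArg (· u) (H.fderiv_congr (F := fun y => G y (fderiv ℝ g y z))
    (F' := fun y => fderiv ℝ g y z) (fun y hy => H.G_dg hy z) hx)
  simp only [fderiv_clm_apply_apply (H.G_diff hx)
    ((H.dg_diff hx).clm_apply (differentiableAt_const z)),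
    fderiv_clm_apply_const_apply (H.dg_diff hx)] at h
  exact eq_sub_of_add_eq (by rw [add_comm]; exact h)

theorem dG_dg_comm (u z : X) :
    fderiv ℝ G x u (fderiv ℝ g x z) = fderiv ℝ G x z (fderiv ℝ g x u) := by
  have h : IsSymmSndFDerivAt ℝ g x := (H.g_smooth x hx).isSymmSndFDerivAt minSmoothness_two_le_infty
  rw [H.dG_dg hx, H.dG_dg hx, h.eq u z]

theorem dG_tangent (u : X) (w : L) : fderiv ℝ G x u w =
    G x (fderiv ℝ G x u w) + fderiv ℝ G x u (G x w) := by
  have h := congrArg (· u) (H.fderiv_congr (F := fun y => G y (G y w))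
    (F' := fun y => G y w) (fun y hy => H.G_idem y hy w) hx)
  simp only [fderiv_clm_apply_apply (H.G_diff hx)
    ((H.G_diff hx).clm_apply (differentiableAt_const w)),
    fderiv_clm_apply_const_apply (H.G_diff hx)] at h
  exact h.symm

omit H hx in
theorem fderiv_form_left {P : X → L →L[ℝ] L} (hP : DifferentiableAt ℝ P x) (p q : L) (u : X) :
    fderiv ℝ (fun y => B (P y p) q) x u = B (fderiv ℝ P x u p) q := by
  have h1 : HasFDerivAt (fun y => P y p) _ x := hP.hasFDerivAt.clm_apply (hasFDerivAt_const p x)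
  have h2 := ((B.flip q).hasFDerivAt (x := P x p)).comp x h1
  have h3 := h2.fderiv
  have : ((B.flip q) ∘ fun y => P y p) = fun y => B (P y p) q := by ext; simp
  rw [this] at h3
  rw [h3]; simp

theorem adj_deriv {P : X → L →L[ℝ] L} (hP : DifferentiableAt ℝ P x)
    (h : ∀ y ∈ O, ∀ p q, B (P y p) q = B p (P y q)) (u : X) (p q : L) :
    B (fderiv ℝ P x u p) q = B p (fderiv ℝ P x u q) := by
  rw [H.symm p, ← fderiv_form_left hP, ← fderiv_form_left hP]
  exact congrArg (· u) (H.fderiv_congr (F := fun y => B (P y p) q)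
    (F' := fun y => B (P y q) p) (fun y hy => by rw [h y hy, H.symm]) hx)

/-- A self-adjoint tangent vector to the idempotents is determined by its values on the range of G.
That range is spanned by g, which DG[u] kills, and the tangent vectors. So the kernel of DG is the
relative nullity. -/
theorem dG_eq_zero_iff {u : X} :
    fderiv ℝ G x u = 0 ↔ ∀ z, fderiv ℝ G x u (fderiv ℝ g x z) = 0 := by
  refine ⟨fun h z => by simp [h], fun h => ContinuousLinearMap.ext fun w => ?_⟩
  refine eq_zero_of_comp_eq_zero H.nondeg (H.G_adj x hx)
    (H.adj_deriv hx (H.G_diff hx) H.G_adj u) (H.dG_tangent hx u) (fun w => ?_) w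
  have := H.dg_S x hx w
  rw [← sub_eq_iff_eq_add] at this
  rw [← this, map_sub, h, map_smul, H.dG_g hx]; simp

end HullChart

namespace NullityChart

variable {B : L →L[ℝ] L →L[ℝ] ℝ} {O : Set X} {g : X → L} {G R : X → L →L[ℝ] L}
  {S : X → L →L[ℝ] X} (H : NullityChart B O g G R S) {x : X} (hx : x ∈ O)
include H hx

theorem R_diff : DifferentiableAt ℝ R x := (H.R_smooth x hx).differentiableAt (by simp)

theorem R_one_sub_G (w : L) : R x (w - G x w) = 0 := by
  rw [H.R_ker x hx, map_sub, H.S_G hx, sub_self, map_zero]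

theorem R_G (w : L) : R x (G x w) = R x w := by
  have := H.R_one_sub_G hx w
  rw [map_sub, sub_eq_zero] at this
  exact this.symm

theorem G_R (w : L) : G x (R x w) = R x w := by
  refine sub_eq_zero.1 (H.nondeg _ fun q => ?_)
  rw [map_sub, sub_apply, H.G_adj x hx, H.R_adj x hx, H.R_adj x hx,
    H.R_G hx, sub_self]

theorem R_g : R x (g x) = 0 := by
  rw [H.R_ker x hx, H.S_g x hx, map_zero]

theorem form_R_g (w : L) : B (R x w) (g x) = 0 := by
  rw [H.R_adj x hx, H.R_g hx, map_zero]

theorem dg_S_R (w : L) : fderiv ℝ g x (S x (R x w)) = R x w := by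
  rw [H.dg_S x hx, H.G_R hx, H.form_R_g hx, zero_smul, add_zero]

theorem dR_tangent (u : X) (w : L) : fderiv ℝ R x u w =
    R x (fderiv ℝ R x u w) + fderiv ℝ R x u (R x w) := by
  have h := congrArg (· u) (H.fderiv_congr (F := fun y => R y (R y w))
    (F' := fun y => R y w) (fun y hy => H.R_idem y hy w) hx)
  simp only [fderiv_clm_apply_apply (H.R_diff hx)
    ((H.R_diff hx).clm_apply (differentiableAt_const w)),
    fderiv_clm_apply_const_apply (H.R_diff hx)] at h
  exact h.symm

theorem dG_eq_zero_iff_R {u : X} : fderiv ℝ G x u = 0 ↔ R x (fderiv ℝ g x u) = 0 := by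
  rw [H.R_ker x hx, H.S_dg x hx]

/-- Constant vectors give sections of the relative nullity. -/
theorem dG_section (w : L) : fderiv ℝ G x (S x (w - R x w)) = 0 := by
  rw [← H.R_ker x hx, map_sub, H.R_idem x hx, sub_self]

theorem section_diff (w : L) : DifferentiableAt ℝ (fun y => S y (w - R y w)) x :=
  (H.S_diff hx).clm_apply
    ((differentiableAt_const w).sub ((H.R_diff hx).clm_apply (differentiableAt_const w)))

theorem section_eq {T : X} (hT : fderiv ℝ G x T = 0) :
    S x (fderiv ℝ g x T - R x (fderiv ℝ g x T)) = T := by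
  rw [(H.dG_eq_zero_iff_R hx).1 hT, sub_zero, H.S_dg x hx]

/-- Differentiating `DΞ[Z] = 0` along a section `Z` of the relative nullity. -/
theorem snd_fderiv_section {W : Type*} [NormedAddCommGroup W] [NormedSpace ℝ W] {F : X → W}
    (hF : ∀ y ∈ O, ContDiffAt ℝ ∞ F y)
    (h0 : ∀ y ∈ O, ∀ T, fderiv ℝ G y T = 0 → fderiv ℝ F y T = 0) {Z : X → X}
    (hZ : DifferentiableAt ℝ Z x) (hZG : ∀ y ∈ O, fderiv ℝ G y (Z y) = 0) (u : X) :
    fderiv ℝ (fderiv ℝ F) x (Z x) u = - fderiv ℝ F x (fderiv ℝ Z x u) := by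
  have hs : IsSymmSndFDerivAt ℝ F x := (hF x hx).isSymmSndFDerivAt minSmoothness_two_le_infty
  have hd : DifferentiableAt ℝ (fderiv ℝ F) x :=
    ((hF x hx).fderiv_right (m := 1) (by norm_cast)).differentiableAt (by simp)
  have h := congrArg (· u) (H.fderiv_congr (F := fun y => fderiv ℝ F y (Z y)) (F' := fun _ => 0)
    (fun y hy => h0 y hy _ (hZG y hy)) hx)
  simp only [fderiv_clm_apply_apply hd hZ] at h
  rw [hs.eq]
  rw [eq_neg_iff_add_eq_zero, add_comm]
  simpa using h

/-- The relative nullity is totally geodesic: the flat derivative of a nullity field in a nullity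
direction has no component in the complement. -/
theorem R_deriv_dg_section {T : X} (hT : fderiv ℝ G x T = 0) {Z : X → X}
    (hZ : DifferentiableAt ℝ Z x) (hZG : ∀ y ∈ O, fderiv ℝ G y (Z y) = 0) :
    R x (fderiv ℝ (fun y => fderiv ℝ g y (Z y)) x T) = 0 := by
  set q := fderiv ℝ (fun y => fderiv ℝ g y (Z y)) x T with hq
  have hdgZ : DifferentiableAt ℝ (fun y => fderiv ℝ g y (Z y)) x := (H.dg_diff hx).clm_apply hZ
  have hGq : G x q = q := by
    have h := congrArg (· T) (H.fderiv_congr (F := fun y => G y (fderiv ℝ g y (Z y)))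
      (F' := fun y => fderiv ℝ g y (Z y)) (fun y hy => H.G_dg hy _) hx)
    simp only [fderiv_clm_apply_apply (H.G_diff hx) hdgZ, hT] at h
    simpa using h
  -- Codazzi equation: differentiating α(z, Z) = 0 along T leaves a second derivative of G.
  -- Extending T to a nullity section turns it into a first derivative, which vanishes on dg Z by
  -- the symmetry of α.
  have hz : ∀ z, fderiv ℝ G x z q = 0 := fun z => by
    have h := congrArg (· T) (H.fderiv_congr
      (F := fun y => fderiv ℝ G y z (fderiv ℝ g y (Z y))) (F' := fun y => 0)
      (fun y hy => by rw [H.dG_dg_comm hy, hZG y hy]; simp) hx)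
    simp only [fderiv_clm_apply_apply ((H.dG_diff hx).clm_apply (differentiableAt_const z)) hdgZ,
      fderiv_clm_apply_const_apply (H.dG_diff hx)] at h
    have h2 := H.snd_fderiv_section hx H.G_smooth (fun _ _ _ h => h)
      (H.section_diff hx (fderiv ℝ g x T)) (fun y hy => H.dG_section hy _) z
    rw [H.section_eq hx hT] at h2
    rw [h2, neg_apply, H.dG_dg_comm hx, hZG x hx] at h
    simpa using h
  rw [H.R_ker x hx, H.dG_eq_zero_iff hx]
  intro z
  rw [H.dG_dg_comm hx, H.dg_S x hx, hGq, map_add, hz, map_smul, H.dG_g hx]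
  simp

/-- The projection `R` is parallel along the relative nullity. -/
theorem dR_eq_zero {T : X} (hT : fderiv ℝ G x T = 0) : fderiv ℝ R x T = 0 := by
  -- It is shown that DR[T] vanishes on ker R, separately on the part normal to the hull and on the
  -- part in the hull.
  have key : ∀ w, fderiv ℝ R x T (w - R x w) = 0 := fun w => by
    have h1 : fderiv ℝ R x T (w - G x w) = 0 := by
      have h := congrArg (· T) (H.fderiv_congr (F := fun y => R y (w - G y w))
        (F' := fun y => 0) (fun y hy => H.R_one_sub_G hy w) hx)
      have hG : DifferentiableAt ℝ (fun y => G y w) x :=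
        (H.G_diff hx).clm_apply (differentiableAt_const w)
      simp only [fderiv_clm_apply_apply (H.R_diff hx) ((differentiableAt_const w).fun_sub hG)] at h
      rw [fderiv_fun_sub (differentiableAt_const w) hG, sub_apply,
        fderiv_clm_apply_const_apply (H.G_diff hx), hT] at h
      simpa using h
    have h2 : fderiv ℝ R x T (G x w - R x w) = 0 := by
      set Z : X → X := fun y => S y (w - R y w)
      have hZ : DifferentiableAt ℝ Z x := H.section_diff hx w
      -- The hull part of ker R is a nullity section plus a multiple of g. The derivatives along T
      -- of both are killed by R, the first one because the nullity is totally geodesic.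
      have hY : ∀ y ∈ O, G y w - R y w = fderiv ℝ g y (Z y) - B w (g y) • g y := fun y hy => by
        rw [H.dg_S y hy, map_sub (G y), H.G_R hy, map_sub B, sub_apply,
          H.form_R_g hy]
        simp
      have hdgZ : DifferentiableAt ℝ (fun y => fderiv ℝ g y (Z y)) x :=
        (H.dg_diff hx).clm_apply hZ
      have hBg : DifferentiableAt ℝ (fun y => B w (g y)) x :=
        (B w).differentiableAt.comp x (H.g_diff hx)
      have hb : DifferentiableAt ℝ (fun y => B w (g y) • g y) x := hBg.smul (H.g_diff hx)
      have h := congrArg (· T) (H.fderiv_congr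
        (F := fun y => R y (fderiv ℝ g y (Z y) - B w (g y) • g y)) (F' := fun y => 0)
        (fun y hy => by
          rw [← hY y hy, map_sub, H.R_idem y hy, H.R_G hy, sub_self]) hx)
      simp only [fderiv_clm_apply_apply (H.R_diff hx) (hdgZ.fun_sub hb)] at h
      rw [fderiv_fun_sub hdgZ hb, fderiv_fun_smul hBg (H.g_diff hx), ← hY x hx] at h
      simp only [sub_apply, map_sub (R x), add_apply,
        smul_apply, ContinuousLinearMap.smulRight_apply, map_add, map_smul] at h
      rw [H.R_deriv_dg_section hx hT hZ (fun y hy => H.dG_section hy w), H.R_g hx,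
        (H.dG_eq_zero_iff_R hx).1 hT] at h
      simpa using h
    have : w - R x w = (w - G x w) + (G x w - R x w) := by abel
    rw [this, map_add, h1, h2, add_zero]
  -- DR[T] is self-adjoint, vanishes on ker R and takes values in ker R; such an operator is zero.
  have hadj := H.adj_deriv hx (H.R_diff hx) H.R_adj T
  have h0 : ∀ w, fderiv ℝ R x T w = fderiv ℝ R x T (R x w) := fun w => by
    have := key w
    rwa [map_sub, sub_eq_zero] at this
  have h1 : ∀ w, R x (fderiv ℝ R x T w) = 0 := fun w => by
    have := H.dR_tangent hx T w
    rw [← h0] at this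
    simpa using this
  ext w
  refine H.nondeg _ fun q => ?_
  rw [hadj, h0 q, ← hadj, ← H.R_adj x hx, h1]
  simp

/-- The structure equation along the relative nullity, for a quantity `F` that is constant in the
nullity directions. -/
theorem fderiv_fderiv_S {W : Type*} [NormedAddCommGroup W] [NormedSpace ℝ W] {F : X → W}
    (hF : ∀ y ∈ O, ContDiffAt ℝ ∞ F y)
    (h0 : ∀ y ∈ O, ∀ T, fderiv ℝ G y T = 0 → fderiv ℝ F y T = 0) {T : X}
    (hT : fderiv ℝ G x T = 0) {h : L} (hh : R x h = h) :
    fderiv ℝ (fun y => fderiv ℝ F y (S y h)) x T =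
      fderiv ℝ F x (S x (fderiv ℝ R x (S x h) (fderiv ℝ g x T))) := by
  set u := S x h with hu
  set w := fderiv ℝ g x T with hw
  have hdgu : fderiv ℝ g x u = h := by rw [hu, ← hh, H.dg_S_R hx]
  have hd : DifferentiableAt ℝ (fderiv ℝ F) x :=
    ((hF x hx).fderiv_right (m := 1) (by norm_cast)).differentiableAt (by simp)
  have hSh : DifferentiableAt ℝ (fun y => S y h) x :=
    (H.S_diff hx).clm_apply (differentiableAt_const h)
  rw [fderiv_clm_apply_apply hd hSh, fderiv_clm_apply_const_apply (H.S_diff hx)]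
  have h2 := H.snd_fderiv_section hx hF h0 (H.section_diff hx w)
    (fun y hy => H.dG_section hy _) u
  rw [H.section_eq hx hT] at h2
  rw [← hu, h2]
  have hRw : DifferentiableAt ℝ (fun y => R y w) x :=
    (H.R_diff hx).clm_apply (differentiableAt_const w)
  rw [fderiv_clm_apply_apply (H.S_diff hx) ((differentiableAt_const w).fun_sub hRw),
    fderiv_fun_sub (differentiableAt_const w) hRw, sub_apply,
    fderiv_clm_apply_const_apply (H.R_diff hx), (H.dG_eq_zero_iff_R hx).1 hT, sub_zero]
  -- Differentiating S(dg b) = b trades the derivative of S for the second derivative of g, whose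
  -- symmetry then allows T and u to be exchanged.
  have hswap : ∀ a b : X, fderiv ℝ S x a (fderiv ℝ g x b) =
      - S x (fderiv ℝ (fderiv ℝ g) x a b) := fun a b => by
    have h := congrArg (· a) (H.fderiv_congr (F := fun y => S y (fderiv ℝ g y b))
      (F' := fun y => b) (fun y hy => H.S_dg y hy b) hx)
    simp only [fderiv_clm_apply_apply (H.S_diff hx)
      ((H.dg_diff hx).clm_apply (differentiableAt_const b)),
      fderiv_clm_apply_const_apply (H.dg_diff hx)] at h
    rw [eq_neg_iff_add_eq_zero, add_comm]
    simpa using h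
  have hs : IsSymmSndFDerivAt ℝ g x := (H.g_smooth x hx).isSymmSndFDerivAt minSmoothness_two_le_infty
  have h3 : fderiv ℝ S x T h = fderiv ℝ S x u w := by
    rw [← hdgu, hw, hswap, hswap, hs.eq T u]
  rw [h3]
  simp

end NullityChart
end Chart

/-! ### Geodesics in the leaves and transport of the extrinsic data along them. -/

section Curve

open Set

theorem eq_zero_of_linear_ode {W : Type*} [NormedAddCommGroup W] [NormedSpace ℝ W] {f : ℝ → W}
    {Λ : ℝ → W →L[ℝ] W} {b : ℝ} (hΛ : ContinuousOn Λ (Icc 0 b))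
    (hf : ∀ t ∈ Icc 0 b, HasDerivAt f (Λ t (f t)) t) (h0 : f 0 = 0) : ∀ t ∈ Icc 0 b, f t = 0 := by
  obtain ⟨K, hK⟩ := isCompact_Icc.exists_bound_of_continuousOn hΛ
  refine eq_zero_of_abs_deriv_le_mul_abs_self_of_eq_zero_right (f' := fun t => Λ t (f t)) (K := K)
    (fun t ht => (hf t ht).continuousAt.continuousWithinAt)
    (fun t ht => (hf t (Ico_subset_Icc_self ht)).hasDerivWithinAt) h0 fun t ht => ?_
  exact (Λ t).le_of_opNorm_le (hK t (Ico_subset_Icc_self ht)) _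

theorem eq_of_hasDerivAt_zero {W : Type*} [NormedAddCommGroup W] [NormedSpace ℝ W] {f : ℝ → W}
    {b : ℝ} (hf : ∀ t ∈ Icc 0 b, HasDerivAt f 0 t) : ∀ t ∈ Icc 0 b, f t = f 0 := by
  intro t ht
  have := eq_zero_of_linear_ode (f := fun t => f t - f 0) (Λ := fun _ => 0) continuousOn_const
    (fun t ht => by simpa using (hf t ht).sub_const (f 0)) (sub_self _) t ht
  exact sub_eq_zero.1 this

variable {X L : Type*} [NormedAddCommGroup X] [NormedSpace ℝ X] [CompleteSpace X]
  [NormedAddCommGroup L] [NormedSpace ℝ L]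

/-- The position on the unit speed geodesic of the hyperboloid from `p` with initial velocity `v`. -/
noncomputable def hypGeodesic (p v : L) (t : ℝ) : L := Real.cosh t • p + Real.sinh t • v

/-- The velocity of `hypGeodesic`. -/
noncomputable def hypGeodesicVel (p v : L) (t : ℝ) : L := Real.sinh t • p + Real.cosh t • v

theorem hasDerivAt_hypGeodesic (p v : L) (t : ℝ) :
    HasDerivAt (hypGeodesic p v) (hypGeodesicVel p v t) t :=
  ((Real.hasDerivAt_cosh t).smul_const p).add ((Real.hasDerivAt_sinh t).smul_const v)

theorem hypGeodesic_add (p v : L) (t s : ℝ) :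
    hypGeodesic (hypGeodesic p v t) (hypGeodesicVel p v t) s = hypGeodesic p v (t + s) := by
  simp only [hypGeodesic, hypGeodesicVel, Real.cosh_add, Real.sinh_add]
  module

theorem form_hypGeodesicVel {B : L →L[ℝ] L →L[ℝ] ℝ} (hs : ∀ p q, B p q = B q p) {p v : L}
    (hp : B p p = -1) (hv : B v v = 1) (hvp : B v p = 0) (t : ℝ) :
    B (hypGeodesicVel p v t) (hypGeodesicVel p v t) = 1 ∧
      B (hypGeodesicVel p v t) (hypGeodesic p v t) = 0 := by
  have h := Real.cosh_sq t
  constructor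
  · simp [hypGeodesicVel, hp, hv, hvp, hs p v]
    nlinarith
  · simp [hypGeodesicVel, hypGeodesic, hp, hv, hvp, hs p v]
    ring

theorem contDiff_hypGeodesicVel (p v : L) : ContDiff ℝ ∞ (hypGeodesicVel p v) := by
  unfold hypGeodesicVel
  exact (Real.contDiff_sinh.smul contDiff_const).add (Real.contDiff_cosh.smul contDiff_const)

namespace NullityChart

variable {B : L →L[ℝ] L →L[ℝ] ℝ} {O : Set X} {g : X → L} {G R : X → L →L[ℝ] L}
  {S : X → L →L[ℝ] X} (H : NullityChart B O g G R S) {x : X} (hx : x ∈ O)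
include H

omit [CompleteSpace X] in
theorem smooth_fderiv_comp_S {W : Type*} [NormedAddCommGroup W] [NormedSpace ℝ W] {F : X → W}
    (hF : ∀ y ∈ O, ContDiffAt ℝ ∞ F y) {y : X} (hy : y ∈ O) :
    ContDiffAt ℝ ∞ (fun y => (fderiv ℝ F y).comp (S y)) y :=
  ((hF y hy).fderiv_right (m := ∞) (by norm_cast)).clm_comp (H.S_smooth y hy)

include hx

omit [CompleteSpace X] in
theorem dR_S_g {h : L} (hh : R x h = h) : fderiv ℝ R x (S x h) (g x) = -h := by
  have h1 := congrArg (· (S x h)) (H.fderiv_congr (F := fun y => R y (g y)) (F' := fun y => 0)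
    (fun y hy => H.R_g hy) hx)
  simp only [fderiv_clm_apply_apply (H.R_diff hx) (H.g_diff hx)] at h1
  rw [← hh, H.dg_S_R hx, H.R_idem x hx, hh] at h1
  rw [eq_neg_iff_add_eq_zero, add_comm]
  simpa using h1

/-- An integral curve of the nullity distribution that follows the projection of the velocity of the
geodesic `hypGeodesic (g x) v`. -/
theorem exists_nullity_curve (v : L) :
    ∃ ε > (0 : ℝ), ∃ γ : ℝ → X, γ 0 = x ∧ ContDiffOn ℝ 1 γ (Icc 0 ε) ∧ ∀ t ∈ Icc 0 ε, γ t ∈ O ∧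
      HasDerivAt γ (S (γ t) (hypGeodesicVel (g x) v t - R (γ t) (hypGeodesicVel (g x) v t))) t := by
  set w := hypGeodesicVel (g x) v
  -- The field depends on time; adjoining time as a coordinate of unit speed makes it autonomous.
  set φ : ℝ × X → ℝ × X := fun q => (1, S q.2 (w q.1 - R q.2 (w q.1))) with hφ
  have hφs : ∀ q : ℝ × X, q.2 ∈ O → ContDiffAt ℝ ∞ φ q := fun q hq => by
    have hw : ContDiffAt ℝ ∞ (fun q : ℝ × X => w q.1) q :=
      ((contDiff_hypGeodesicVel (g x) v).comp contDiff_fst).contDiffAt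
    have hR : ContDiffAt ℝ ∞ (fun q : ℝ × X => R q.2) q := (H.R_smooth _ hq).comp q contDiffAt_snd
    have hS : ContDiffAt ℝ ∞ (fun q : ℝ × X => S q.2) q := (H.S_smooth _ hq).comp q contDiffAt_snd
    exact contDiffAt_const.prodMk (hS.clm_apply (hw.sub (hR.clm_apply hw)))
  obtain ⟨α, hα0, ε, hε, hα⟩ :=
    ((hφs (0, x) hx).of_le (by norm_cast)
      ).exists_forall_mem_closedBall_exists_eq_forall_mem_Ioo_hasDerivAt₀ (0 : ℝ)
  have hc : ContinuousAt α 0 := (hα 0 (by constructor <;> linarith)).continuousAt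
  have hO : ∀ᶠ t in nhds (0 : ℝ), (α t).2 ∈ O :=
    (continuousAt_snd.comp hc).eventually_mem (by
      simpa [hα0] using H.isOpen.mem_nhds hx)
  obtain ⟨δ, hδ, hδO⟩ := Metric.eventually_nhds_iff.1 hO
  set η := min ε δ with hη
  have hη0 : 0 < η := lt_min hε hδ
  have hD : ∀ t ∈ Ioo (-η) η, (α t).2 ∈ O ∧ HasDerivAt α (φ (α t)) t := fun t ht => by
    refine ⟨hδO ?_, hα t ⟨?_, ?_⟩⟩
    · rw [Real.dist_eq, sub_zero]
      exact (abs_lt.2 ht).trans_le (min_le_right _ _)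
    · have := ht.1; have := min_le_left ε δ; linarith
    · have := ht.2; have := min_le_left ε δ; linarith
  have hC : ContDiffOn ℝ 1 α (Ioo (-η) η) := by
    rw [show (1 : WithTop ℕ∞) = 0 + 1 from rfl, contDiffOn_succ_iff_deriv_of_isOpen isOpen_Ioo]
    refine ⟨fun t ht => (hD t ht).2.differentiableAt.differentiableWithinAt, by simp, ?_⟩
    rw [contDiffOn_zero]
    refine ContinuousOn.congr (f := fun t => φ (α t)) (fun t ht => ?_) (fun t ht => (hD t ht).2.deriv)
    exact ((hφs _ (hD t ht).1).continuousAt.comp (hD t ht).2.continuousAt).continuousWithinAt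
  have hsub : Icc 0 (η / 2) ⊆ Ioo (-η) η := fun t ht => ⟨by linarith [ht.1], by linarith [ht.2]⟩
  have h1 : ∀ t ∈ Icc 0 (η / 2), (α t).1 = t := fun t ht => by
    have := eq_of_hasDerivAt_zero (f := fun t => (α t).1 - t) (b := η / 2) (fun t ht => by
      have h : HasDerivAt (fun t => (α t).1) _ t :=
        (hasFDerivAt_fst (p := α t)).comp_hasDerivAt t (hD t (hsub ht)).2
      have h := h.fun_sub (hasDerivAt_id' t)
      simpa [hφ] using h) t ht
    simp only [hα0] at this
    linarith
  refine ⟨η / 2, by linarith, fun t => (α t).2, by simp [hα0], ?_, fun t ht =>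
    ⟨(hD t (hsub ht)).1, ?_⟩⟩
  · exact contDiff_snd.comp_contDiffOn (hC.mono hsub)
  · have h : HasDerivAt (fun t => (α t).2) _ t :=
      (hasFDerivAt_snd (p := α t)).comp_hasDerivAt t (hD t (hsub ht)).2
    simp only [hφ, h1 t ht] at h
    exact h

/-- Local structure of a leaf of the relative nullity: from `x`, the geodesic of the hyperboloid in
a nullity direction `v` can be followed for a short time; the tangent space and the nullity are
constant along it and the second fundamental form and the splitting tensor are obtained from their
values at `x` through the Jacobi fields `h ↦ -DR[S h] (g (γ t))`. -/
theorem exists_leaf_curve {v : L} (hG : G x v = v) (hR : R x v = 0) (hv : B v v = 1)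
    (hvg : B v (g x) = 0) :
    ∃ ε > (0 : ℝ), ∃ γ : ℝ → X, γ 0 = x ∧ ContDiffOn ℝ 1 γ (Icc 0 ε) ∧ ∀ t ∈ Icc 0 ε, γ t ∈ O ∧
      g (γ t) = hypGeodesic (g x) v t ∧ G (γ t) = G x ∧ R (γ t) = R x ∧
      (∃ T, HasDerivAt γ T t ∧ fderiv ℝ g (γ t) T = hypGeodesicVel (g x) v t) ∧
      ∀ h, R x h = h →
        fderiv ℝ R (γ t) (S (γ t) (-fderiv ℝ R x (S x h) (g (γ t)))) = fderiv ℝ R x (S x h) ∧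
        fderiv ℝ G (γ t) (S (γ t) (-fderiv ℝ R x (S x h) (g (γ t)))) = fderiv ℝ G x (S x h) := by
  obtain ⟨ε, hε, γ, hγ0, hγC, hγ⟩ := H.exists_nullity_curve hx v
  set w := hypGeodesicVel (g x) v with hw
  set T : ℝ → X := fun t => S (γ t) (w t - R (γ t) (w t)) with hT
  have hTG : ∀ t ∈ Icc 0 ε, fderiv ℝ G (γ t) (T t) = 0 := fun t ht =>
    H.dG_section (hγ t ht).1 (w t)
  have hcomp : ∀ {W : Type _} [NormedAddCommGroup W] [NormedSpace ℝ W] (F : X → W) (t : ℝ),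
      t ∈ Icc 0 ε → ContDiffAt ℝ ∞ F (γ t) →
      HasDerivAt (fun t => F (γ t)) (fderiv ℝ F (γ t) (T t)) t := fun F t ht hF =>
    (hF.differentiableAt (by simp)).hasFDerivAt.comp_hasDerivAt t (hγ t ht).2
  have hGc : ∀ t ∈ Icc 0 ε, G (γ t) = G x := fun t ht => by
    have := eq_of_hasDerivAt_zero (f := fun t => G (γ t)) (b := ε) (fun t ht => by
      simpa only [hTG t ht] using hcomp G t ht (H.G_smooth _ (hγ t ht).1)) t ht
    simpa only [hγ0] using this
  have hRc : ∀ t ∈ Icc 0 ε, R (γ t) = R x := fun t ht => by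
    have := eq_of_hasDerivAt_zero (f := fun t => R (γ t)) (b := ε) (fun t ht => by
      simpa only [H.dR_eq_zero (hγ t ht).1 (hTG t ht)] using
        hcomp R t ht (H.R_smooth _ (hγ t ht).1)) t ht
    simpa only [hγ0] using this
  have hwR : ∀ t, R x (w t) = 0 := fun t => by
    simp [hw, hypGeodesicVel, H.R_g hx, hR]
  have hwG : ∀ t, G x (w t) = w t := fun t => by
    simp [hw, hypGeodesicVel, H.G_g hx, hG]
  have hwc : ∀ t, B (w t) (hypGeodesic (g x) v t) = 0 := fun t =>
    (form_hypGeodesicVel H.symm (H.form_g x hx) hv hvg t).2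
  have hdg : ∀ t ∈ Icc 0 ε, fderiv ℝ g (γ t) (T t) = w t + B (w t) (g (γ t)) • g (γ t) :=
    fun t ht => by
      simp only [hT]
      rw [H.dg_S _ (hγ t ht).1, hRc t ht, hwR, sub_zero, hGc t ht, hwG]
  have hgc : ∀ t ∈ Icc 0 ε, ContinuousAt (fun t => g (γ t)) t := fun t ht =>
    (hcomp g t ht (H.g_smooth _ (hγ t ht).1)).continuousAt
  have hwcont : Continuous w := (contDiff_hypGeodesicVel (g x) v).continuous
  -- The velocity of g ∘ γ is w + B(w, g) g, and B(w, ·) vanishes on the hyperbolic geodesic. So the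
  -- difference of the two curves solves a homogeneous linear equation with zero initial value.
  have hgeo : ∀ t ∈ Icc 0 ε, g (γ t) = hypGeodesic (g x) v t := fun t ht => by
    refine sub_eq_zero.1 (eq_zero_of_linear_ode (b := ε)
      (f := fun t => g (γ t) - hypGeodesic (g x) v t)
      (Λ := fun t => (B (w t)).smulRight (g (γ t))) (fun t ht => ?_) (fun t ht => ?_) ?_ t ht)
    · have h1 : ContinuousAt (fun t => B (w t)) t := (B.continuous.comp hwcont).continuousAt
      exact ((ContinuousLinearMap.smulRightL ℝ L L).continuous₂.continuousAt.comp
        (h1.prodMk (hgc t ht))).continuousWithinAt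
    · have h := (hcomp g t ht (H.g_smooth _ (hγ t ht).1)).fun_sub (hasDerivAt_hypGeodesic (g x) v t)
      rw [hdg t ht] at h
      convert h using 1
      rw [ContinuousLinearMap.smulRight_apply, map_sub, hwc, sub_zero, ← hw]
      abel
    · simp [hγ0, hypGeodesic]
  have hdgw : ∀ t ∈ Icc 0 ε, fderiv ℝ g (γ t) (T t) = w t := fun t ht => by
    rw [hdg t ht, hgeo t ht, hwc, zero_smul, add_zero]
  refine ⟨ε, hε, γ, hγ0, hγC, fun t ht => ⟨(hγ t ht).1, hgeo t ht, hGc t ht, hRc t ht,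
    ⟨T t, (hγ t ht).2, hdgw t ht⟩, fun h hh => ?_⟩⟩
  set J : ℝ → L := fun t => -fderiv ℝ R x (S x h) (g (γ t)) with hJ
  have hJR : ∀ t ∈ Icc 0 ε, R (γ t) (J t) = J t := fun t ht => by
    have h1 := H.dR_tangent hx (S x h) (g (γ t))
    rw [← hRc t ht, H.R_g (hγ t ht).1, map_zero, add_zero] at h1
    simp only [hJ, map_neg]
    rw [← h1]
  have hJ' : ∀ t ∈ Icc 0 ε, HasDerivAt J (-fderiv ℝ R x (S x h) (w t)) t := fun t ht => by
    have h1 := hcomp g t ht (H.g_smooth _ (hγ t ht).1)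
    rw [hdgw t ht] at h1
    exact ((fderiv ℝ R x (S x h)).hasFDerivAt.comp_hasDerivAt t h1).neg
  -- For F constant along the nullity, the derivative of DF[J] is governed by the defect DR[J] -
  -- DR[h], where DR[h] is taken at x. Taking F = R gives a linear equation for the defect itself,
  -- which vanishes at t = 0 because J(0) = h; then F = G shows that DG[J] is constant.
  have hmain : ∀ {W : Type _} [NormedAddCommGroup W] [NormedSpace ℝ W] (F : X → W)
      (hF : ∀ y ∈ O, ContDiffAt ℝ ∞ F y)
      (h0 : ∀ y ∈ O, ∀ T, fderiv ℝ G y T = 0 → fderiv ℝ F y T = 0), ∀ t ∈ Icc 0 ε,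
      HasDerivAt (fun t => fderiv ℝ F (γ t) (S (γ t) (J t)))
        (fderiv ℝ F (γ t) (S (γ t)
          ((fderiv ℝ R (γ t) (S (γ t) (J t)) - fderiv ℝ R x (S x h)) (w t)))) t := by
    intro W _ _ F hF h0 t ht
    have h1 := hcomp _ t ht (H.smooth_fderiv_comp_S hF (hγ t ht).1)
    have h2 := h1.clm_apply (hJ' t ht)
    have h3 := H.fderiv_fderiv_S (hγ t ht).1 hF h0 (hTG t ht) (hJR t ht)
    have h4 := fderiv_clm_apply_const_apply
      ((H.smooth_fderiv_comp_S hF (hγ t ht).1).differentiableAt (by simp)) (J t) (T t)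
    simp only [ContinuousLinearMap.comp_apply] at h2 h4
    rw [← h4, h3, hdgw t ht] at h2
    convert h2 using 1
    simp only [sub_apply, map_sub, map_neg]
    abel
  have hL : ∀ t ∈ Icc 0 ε, fderiv ℝ R (γ t) (S (γ t) (J t)) - fderiv ℝ R x (S x h) = 0 := by
    have hcont : ∀ t ∈ Icc 0 ε,
        ContinuousAt (fun t => (fderiv ℝ R (γ t)).comp (S (γ t))) t := fun t ht =>
      (hcomp _ t ht (H.smooth_fderiv_comp_S H.R_smooth (hγ t ht).1)).continuousAt
    refine eq_zero_of_linear_ode (b := ε) (Λ := fun t => ((fderiv ℝ R (γ t)).comp (S (γ t))).comp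
      (ContinuousLinearMap.apply ℝ L (w t))) (fun t ht => ?_) (fun t ht => ?_) ?_
    · exact ((hcont t ht).clm_comp
        ((ContinuousLinearMap.apply ℝ L).continuous.comp hwcont).continuousAt).continuousWithinAt
    · exact (hmain R H.R_smooth (fun y hy T => H.dR_eq_zero hy) t ht).sub_const _
    · simp only [hJ, hγ0, H.dR_S_g hx hh, neg_neg, sub_self]
  refine ⟨sub_eq_zero.1 (hL t ht), ?_⟩
  have := eq_of_hasDerivAt_zero (f := fun t => fderiv ℝ G (γ t) (S (γ t) (J t))) (b := ε)
    (fun t ht => by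
      have h1 := hmain G H.G_smooth (fun y hy T h => h) t ht
      rw [hL t ht] at h1
      simpa using h1) t ht
  simpa only [hJ, hγ0, H.dR_S_g hx hh, neg_neg] using this

end NullityChart
end Curve

/-! ### Orthogonal projections for an indefinite form, and their smooth dependence on data. -/

section LinearAlgebra

variable {X X' L F W : Type*} [NormedAddCommGroup X] [NormedSpace ℝ X] [FiniteDimensional ℝ X]
  [NormedAddCommGroup X'] [NormedSpace ℝ X'] [FiniteDimensional ℝ X']
  [NormedAddCommGroup L] [NormedSpace ℝ L] [NormedAddCommGroup W] [NormedSpace ℝ W]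
  [NormedAddCommGroup F] [NormedSpace ℝ F] [FiniteDimensional ℝ F]

theorem isInvertible_of_injective {Y Y' : Type*} [NormedAddCommGroup Y] [NormedSpace ℝ Y]
    [NormedAddCommGroup Y'] [NormedSpace ℝ Y'] [FiniteDimensional ℝ Y] [FiniteDimensional ℝ Y']
    (h : Module.finrank ℝ Y = Module.finrank ℝ Y') (T : Y →L[ℝ] Y') (hT : ∀ u, T u = 0 → u = 0) :
    T.IsInvertible := by
  have hinj : Function.Injective (T : Y →ₗ[ℝ] Y') := (injective_iff_map_eq_zero _).2 hT
  refine ⟨(LinearEquiv.ofInjectiveOfFinrankEq (T : Y →ₗ[ℝ] Y') hinj h).toContinuousLinearEquiv, ?_⟩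
  ext u; rfl

omit [FiniteDimensional ℝ X] in
theorem finrank_continuousDual [FiniteDimensional ℝ X] :
    Module.finrank ℝ (X →L[ℝ] ℝ) = Module.finrank ℝ X := by
  rw [← (LinearMap.toContinuousLinearMap (𝕜 := ℝ) (E := X) (F' := ℝ)).finrank_eq]
  exact Subspace.dual_finrank_eq

/-- The map `w ↦ B(w, d ·)`. -/
noncomputable def formPullback (B : L →L[ℝ] L →L[ℝ] ℝ) (d : X →L[ℝ] L) : L →L[ℝ] X →L[ℝ] ℝ :=
  ((ContinuousLinearMap.compL ℝ X L ℝ).flip d).comp B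

omit [FiniteDimensional ℝ X] in
@[simp] theorem formPullback_apply (B : L →L[ℝ] L →L[ℝ] ℝ) (d : X →L[ℝ] L) (w : L) (u : X) :
    formPullback B d w u = B w (d u) := rfl

/-- For `d` with `B` positive definite on its range, the `B`-orthogonal projection onto the range
followed by the inverse of `d`. -/
noncomputable def tangentialInverse (B : L →L[ℝ] L →L[ℝ] ℝ) (d : X →L[ℝ] L) : L →L[ℝ] X :=
  ((formPullback B d).comp d).inverse.comp (formPullback B d)

theorem isInvertible_gram {B : L →L[ℝ] L →L[ℝ] ℝ} {d : X →L[ℝ] L}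
    (hd : ∀ u, u ≠ 0 → 0 < B (d u) (d u)) : ((formPullback B d).comp d).IsInvertible := by
  refine isInvertible_of_injective finrank_continuousDual.symm _ fun u hu => ?_
  by_contra h
  have := DFunLike.congr_fun hu u
  simp at this
  exact (hd u h).ne' this

theorem form_tangentialInverse {B : L →L[ℝ] L →L[ℝ] ℝ} {d : X →L[ℝ] L}
    (hd : ∀ u, u ≠ 0 → 0 < B (d u) (d u)) (w : L) (z : X) :
    B (d (tangentialInverse B d w)) (d z) = B w (d z) := by
  have h : ((formPullback B d).comp d) (tangentialInverse B d w) = formPullback B d w :=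
    ((isInvertible_gram hd).inverse_apply_eq.1 rfl).symm
  exact DFunLike.congr_fun h z

theorem tangentialInverse_eq {B : L →L[ℝ] L →L[ℝ] ℝ} {d : X →L[ℝ] L}
    (hd : ∀ u, u ≠ 0 → 0 < B (d u) (d u)) {w : L} {u : X} (h : ∀ z, B (d u) (d z) = B w (d z)) :
    tangentialInverse B d w = u := by
  refine (isInvertible_gram hd).inverse_apply_eq.2 ?_
  ext z
  simp [h]

theorem contDiffAt_tangentialInverse {B : L →L[ℝ] L →L[ℝ] ℝ} {d : X →L[ℝ] L}
    (hd : ∀ u, u ≠ 0 → 0 < B (d u) (d u)) : ContDiffAt ℝ ∞ (tangentialInverse (X := X) B) d := by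
  have h1 : ContDiff ℝ ∞ (fun d : X →L[ℝ] L => formPullback B d) := by
    have h0 : ContDiff ℝ ∞ (fun d : X →L[ℝ] L => (ContinuousLinearMap.compL ℝ X L ℝ).flip d) :=
      ContinuousLinearMap.contDiff _
    exact h0.clm_comp contDiff_const
  have h2 : ContDiffAt ℝ ∞ (fun d : X →L[ℝ] L => (formPullback B d).comp d) d :=
    (h1.clm_comp contDiff_id).contDiffAt
  have : CompleteSpace X := FiniteDimensional.complete ℝ X
  have h3 : ContDiffAt ℝ ∞ (fun d : X →L[ℝ] L => ((formPullback B d).comp d).inverse) d :=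
    ContDiffAt.comp (g := ContinuousLinearMap.inverse) (f := fun d => (formPullback B d).comp d) d
      (isInvertible_gram hd).contDiffAt_map_inverse h2
  exact h3.clm_comp h1.contDiffAt

/-- The `B`-orthogonal projection onto the span of `p` and the range of `d`, when `B(p, p) = -1` and
`p` is orthogonal to the range of `d`. -/
noncomputable def hullProjection (B : L →L[ℝ] L →L[ℝ] ℝ) (p : L) (d : X →L[ℝ] L) : L →L[ℝ] L :=
  d.comp (tangentialInverse B d) - (B.flip p).smulRight p

omit [FiniteDimensional ℝ X] in
theorem hullProjection_apply (B : L →L[ℝ] L →L[ℝ] ℝ) (p : L) (d : X →L[ℝ] L) (w : L) :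
    hullProjection B p d w = d (tangentialInverse B d w) - B w p • p := rfl

/-- A change of frame in the tangent space alters only the coordinates of the answer. This makes the
constructions below independent of the chart. -/
theorem tangentialInverse_comp {B : L →L[ℝ] L →L[ℝ] ℝ} {d : X →L[ℝ] L}
    (hd : ∀ u, u ≠ 0 → 0 < B (d u) (d u)) (e : X' ≃L[ℝ] X) (w : L) :
    tangentialInverse B (d.comp (e : X' →L[ℝ] X)) w = e.symm (tangentialInverse B d w) := by
  refine tangentialInverse_eq (d := d.comp (e : X' →L[ℝ] X)) (fun u hu => hd (e u) (by simpa using hu)) fun z => ?_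
  simp [form_tangentialInverse hd]

theorem hullProjection_comp {B : L →L[ℝ] L →L[ℝ] ℝ} {d : X →L[ℝ] L}
    (hd : ∀ u, u ≠ 0 → 0 < B (d u) (d u)) (p : L) (e : X' ≃L[ℝ] X) :
    hullProjection B p (d.comp (e : X' →L[ℝ] X)) = hullProjection B p d := by
  ext w
  simp [hullProjection_apply, tangentialInverse_comp hd]

theorem tangentialInverse_self {B : L →L[ℝ] L →L[ℝ] ℝ} {d : X →L[ℝ] L}
    (hd : ∀ u, u ≠ 0 → 0 < B (d u) (d u)) (u : X) : tangentialInverse B d (d u) = u :=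
  tangentialInverse_eq hd fun _ => rfl

theorem tangentialInverse_normal {B : L →L[ℝ] L →L[ℝ] ℝ} {d : X →L[ℝ] L}
    (hd : ∀ u, u ≠ 0 → 0 < B (d u) (d u)) {w : L} (hw : ∀ u, B w (d u) = 0) :
    tangentialInverse B d w = 0 :=
  tangentialInverse_eq hd fun z => by simp [hw]

theorem hullProjection_idem {B : L →L[ℝ] L →L[ℝ] ℝ} (hs : ∀ p q, B p q = B q p)
    {d : X →L[ℝ] L} (hd : ∀ u, u ≠ 0 → 0 < B (d u) (d u)) {p : L} (hp : B p p = -1)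
    (hdp : ∀ u, B (d u) p = 0) (w : L) :
    hullProjection B p d (hullProjection B p d w) = hullProjection B p d w := by
  have h1 : tangentialInverse B d p = 0 :=
    tangentialInverse_normal hd fun u => by rw [hs, hdp]
  simp [hullProjection_apply, tangentialInverse_self hd, h1, hp, hdp]

theorem hullProjection_adj {B : L →L[ℝ] L →L[ℝ] ℝ} (hs : ∀ p q, B p q = B q p)
    {d : X →L[ℝ] L} (hd : ∀ u, u ≠ 0 → 0 < B (d u) (d u)) (p w z : L) :
    B (hullProjection B p d w) z = B w (hullProjection B p d z) := by
  have h1 : B (d (tangentialInverse B d w)) z = B w (d (tangentialInverse B d z)) := by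
    rw [hs, ← form_tangentialInverse hd z, hs, form_tangentialInverse hd w]
  simp [hullProjection_apply, h1, hs p z]
  ring

/-- `R` is the `B`-orthogonal projection with kernel `ker K`. -/
structure IsOrthogonalProjectionAlong (B : L →L[ℝ] L →L[ℝ] ℝ) (K : L →L[ℝ] W)
    (R : L →L[ℝ] L) : Prop where
  idem : ∀ w, R (R w) = R w
  adj : ∀ p q, B (R p) q = B p (R q)
  ker : ∀ w, R w = 0 ↔ K w = 0

/-- Idempotents with the same kernel absorb each other on one side, and self-adjointness then makes
them equal. Thus a projection obtained by choice agrees with the explicit smooth formula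
`projectionAlong`. -/
theorem IsOrthogonalProjectionAlong.unique {B : L →L[ℝ] L →L[ℝ] ℝ}
    (hnd : ∀ p, (∀ q, B p q = 0) → p = 0) {K : L →L[ℝ] W} {R R' : L →L[ℝ] L}
    (h : IsOrthogonalProjectionAlong B K R) (h' : IsOrthogonalProjectionAlong B K R') : R = R' := by
  have h1 : ∀ w, R (R' w) = R w := fun w => by
    rw [← sub_eq_zero, ← map_sub, h.ker, ← h'.ker, map_sub, h'.idem, sub_self]
  have h2 : ∀ w, R' (R w) = R' w := fun w => by
    rw [← sub_eq_zero, ← map_sub, h'.ker, ← h.ker, map_sub, h.idem, sub_self]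
  ext w
  refine sub_eq_zero.1 (hnd _ fun q => ?_)
  rw [map_sub, sub_apply, h.adj, h'.adj, ← h1 q, ← h.adj, ← h'.adj, h2]
  rw [h'.adj]
  simp

/-- The `B`-adjoint of `K`. -/
noncomputable def formSharp (B : L →L[ℝ] L →L[ℝ] ℝ) (K : L →L[ℝ] F) : (F →L[ℝ] ℝ) →L[ℝ] L :=
  B.inverse.comp ((ContinuousLinearMap.compL ℝ L F ℝ).flip K)

/-- A formula for the `B`-orthogonal projection with kernel `ker K`. -/
noncomputable def projectionAlong (B : L →L[ℝ] L →L[ℝ] ℝ) (K : L →L[ℝ] F) : L →L[ℝ] L :=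
  ((formSharp B K).comp (K.comp (formSharp B K)).inverse).comp K

omit [FiniteDimensional ℝ F] in
theorem form_formSharp [FiniteDimensional ℝ L] {B : L →L[ℝ] L →L[ℝ] ℝ}
    (hnd : ∀ p, (∀ q, B p q = 0) → p = 0) (K : L →L[ℝ] F) (l : F →L[ℝ] ℝ) (q : L) :
    B (formSharp B K l) q = l (K q) := by
  have hB : B.IsInvertible := isInvertible_of_injective finrank_continuousDual.symm B
    fun u hu => hnd u fun q => by simp [hu]
  have h : B (formSharp B K l) = l.comp K := (hB.inverse_apply_eq.1 rfl).symm
  rw [h]; rfl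

/-- If K K♯ l = 0, where K♯ is the adjoint, then K♯ l is null and orthogonal to ker K. Since B is
indefinite this does not give K♯ l = 0 by itself, and `hpos` supplies it. -/
theorem isInvertible_projectionAlong [FiniteDimensional ℝ L] {B : L →L[ℝ] L →L[ℝ] ℝ}
    (hnd : ∀ p, (∀ q, B p q = 0) → p = 0) {K : L →L[ℝ] F} (hK : Function.Surjective K)
    (hpos : ∀ w, (∀ z, K z = 0 → B w z = 0) → B w w = 0 → w = 0) :
    (K.comp (formSharp B K)).IsInvertible := by
  refine isInvertible_of_injective finrank_continuousDual _ fun l hl => ?_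
  have h0 : formSharp B K l = 0 := by
    refine hpos _ (fun z hz => by rw [form_formSharp hnd, hz, map_zero]) ?_
    rw [form_formSharp hnd]
    have : K (formSharp B K l) = 0 := hl
    rw [this, map_zero]
  ext a
  obtain ⟨w, rfl⟩ := hK a
  rw [← form_formSharp hnd, h0]
  simp

omit [FiniteDimensional ℝ F] in
theorem isOrthogonalProjectionAlong [FiniteDimensional ℝ L] {B : L →L[ℝ] L →L[ℝ] ℝ}
    (hs : ∀ p q, B p q = B q p) (hnd : ∀ p, (∀ q, B p q = 0) → p = 0) {K : L →L[ℝ] F}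
    (h : (K.comp (formSharp B K)).IsInvertible) :
    IsOrthogonalProjectionAlong B K (projectionAlong B K) := by
  have h1 : ∀ a, K (formSharp B K ((K.comp (formSharp B K)).inverse a)) = a := fun a =>
    (h.inverse_apply_eq.1 rfl).symm
  have h2 : ∀ w, K (projectionAlong B K w) = K w := fun w => h1 _
  have h3 : ∀ w, projectionAlong B K w = formSharp B K ((K.comp (formSharp B K)).inverse (K w)) :=
    fun w => rfl
  refine ⟨fun w => ?_, fun p q => ?_, fun w => ⟨fun hw => ?_, fun hw => ?_⟩⟩
  · rw [h3 (projectionAlong B K w), h2, ← h3]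
  · rw [hs p, h3 p, h3 q, form_formSharp hnd, form_formSharp hnd]
    conv_lhs => rw [← h1 (K q)]
    conv_rhs => rw [← h1 (K p)]
    rw [← form_formSharp hnd, ← form_formSharp hnd, hs]
  · rw [← h2, hw, map_zero]
  · rw [h3, hw, map_zero, map_zero]

omit [FiniteDimensional ℝ F] in
theorem contDiffAt_projectionAlong {B : L →L[ℝ] L →L[ℝ] ℝ} {K : L →L[ℝ] F}
    (h : (K.comp (formSharp B K)).IsInvertible) :
    ContDiffAt ℝ ∞ (projectionAlong (F := F) B) K := by
  have h1 : ContDiff ℝ ∞ (fun K : L →L[ℝ] F => formSharp B K) := by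
    have h0 : ContDiff ℝ ∞ (fun K : L →L[ℝ] F => (ContinuousLinearMap.compL ℝ L F ℝ).flip K) :=
      ContinuousLinearMap.contDiff _
    exact contDiff_const.clm_comp h0
  have h2 : ContDiffAt ℝ ∞ (fun K : L →L[ℝ] F => K.comp (formSharp B K)) K :=
    (contDiff_id.clm_comp h1).contDiffAt
  have : CompleteSpace (F →L[ℝ] ℝ) := inferInstance
  have h3 : ContDiffAt ℝ ∞ (fun K : L →L[ℝ] F => (K.comp (formSharp B K)).inverse) K :=
    ContDiffAt.comp (g := ContinuousLinearMap.inverse) (f := fun K => K.comp (formSharp B K)) K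
      h.contDiffAt_map_inverse h2
  have h4 : ContDiffAt ℝ ∞ (fun K : L →L[ℝ] F =>
      (formSharp B K).comp (K.comp (formSharp B K)).inverse) K := h1.contDiffAt.clm_comp h3
  exact h4.clm_comp contDiffAt_id

/-- The rank of a continuous linear map. -/
noncomputable def clmRank (A : L →L[ℝ] W) : ℕ :=
  Module.finrank ℝ (LinearMap.range (A : L →ₗ[ℝ] W))

/-- Near `A₀` the rank does not drop, as witnessed by a fixed map onto the range of `A₀`. -/
theorem exists_surjective_near [FiniteDimensional ℝ L] (A₀ : L →L[ℝ] W) :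
    ∃ Λ : W →L[ℝ] (Fin (clmRank A₀) → ℝ),
      ∀ᶠ A in nhds A₀, Function.Surjective (Λ.comp A) := by
  set V := LinearMap.range (A₀ : L →ₗ[ℝ] W)
  obtain ⟨Λ, hΛ⟩ := Submodule.ClosedComplemented.of_finiteDimensional V
  obtain ⟨s, hs⟩ := (A₀ : L →ₗ[ℝ] W).rangeRestrict.exists_rightInverse_of_surjective
    (LinearMap.range_rangeRestrict _)
  set ι : V →L[ℝ] L := LinearMap.toContinuousLinearMap s
  have h0 : (Λ.comp A₀).comp ι = 1 := by
    ext v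
    have h1 := DFunLike.congr_fun hs v
    have h2 : A₀ (s v) = v := congrArg Subtype.val h1
    have h3 : Λ (A₀ (s v)) = v := by rw [h2]; exact hΛ v
    exact congrArg Subtype.val h3
  obtain ⟨e⟩ : Nonempty (V ≃L[ℝ] (Fin (clmRank A₀) → ℝ)) :=
    FiniteDimensional.nonempty_continuousLinearEquiv_of_finrank_eq (by
      rw [Module.finrank_fin_fun]; rfl)
  refine ⟨(e : V →L[ℝ] (Fin (clmRank A₀) → ℝ)).comp Λ, ?_⟩
  have hc : Continuous fun A : L →L[ℝ] W => (Λ.comp A).comp ι :=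
    (continuous_const.clm_comp continuous_id).clm_comp continuous_const
  have hU : ∀ᶠ A in nhds A₀, IsUnit ((Λ.comp A).comp ι) := by
    have : CompleteSpace V := FiniteDimensional.complete ℝ V
    refine hc.continuousAt.eventually_mem (s := {T : V →L[ℝ] V | IsUnit T}) ?_
    rw [h0]
    exact (Units.isOpen (R := V →L[ℝ] V)).mem_nhds isUnit_one
  filter_upwards [hU] with A hA a
  obtain ⟨T, hT⟩ := hA
  refine ⟨ι ((T⁻¹ : (V →L[ℝ] V)ˣ).1 (e.symm a)), ?_⟩
  change e (((Λ.comp A).comp ι) _) = a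
  rw [← hT]
  refine (congrArg e ?_).trans (e.apply_symm_apply a)
  exact DFunLike.congr_fun T.mul_inv (e.symm a)

/-- The rank bound forces Λ, which maps the range of A onto F, to be injective on that range. -/
theorem ker_eq_of_surjective [FiniteDimensional ℝ L] {A : L →L[ℝ] W} {Λ : W →L[ℝ] F}
    (h : Function.Surjective (Λ.comp A)) (hr : clmRank A ≤ Module.finrank ℝ F) (w : L) :
    Λ (A w) = 0 ↔ A w = 0 := by
  refine ⟨fun hw => ?_, fun hw => by rw [hw, map_zero]⟩
  set f : LinearMap.range (A : L →ₗ[ℝ] W) →ₗ[ℝ] F :=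
    (Λ : W →ₗ[ℝ] F).comp (Submodule.subtype _)
  have hf : Function.Surjective f := fun a => by
    obtain ⟨w, hw⟩ := h a
    exact ⟨⟨A w, w, rfl⟩, hw⟩
  have hle := LinearMap.finrank_le_finrank_of_surjective hf
  have hinj : Function.Injective f :=
    (LinearMap.injective_iff_surjective_of_finrank_eq_finrank (le_antisymm hr hle)).2 hf
  have : (⟨A w, w, rfl⟩ : LinearMap.range (A : L →ₗ[ℝ] W)) = 0 :=
    hinj (by rw [map_zero]; exact hw)
  exact congrArg Subtype.val this

omit [FiniteDimensional ℝ F] in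
theorem le_clmRank_of_surjective [FiniteDimensional ℝ L] {A : L →L[ℝ] W} {Λ : W →L[ℝ] F}
    (h : Function.Surjective (Λ.comp A)) : Module.finrank ℝ F ≤ clmRank A := by
  refine LinearMap.finrank_le_finrank_of_surjective
    (f := (Λ : W →ₗ[ℝ] F).comp (Submodule.subtype (LinearMap.range (A : L →ₗ[ℝ] W)))) fun a => ?_
  obtain ⟨w, hw⟩ := h a
  exact ⟨⟨A w, w, rfl⟩, hw⟩

end LinearAlgebra

/-! ### Immersions into the hyperboloid: chart-free operators and their smoothness. -/

section HyperboloidImmersion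

open Set

variable {n : ℕ} {M : Type*} [TopologicalSpace M] [ChartedSpace (EuclideanSpace ℝ (Fin n)) M]
  {L W : Type*} [NormedAddCommGroup L] [NormedSpace ℝ L]
  [NormedAddCommGroup W] [NormedSpace ℝ W]

variable (n) in
/-- The differential of a vector-valued map, with the tangent space read in the preferred chart. -/
noncomputable def differential (F : M → W) (x : M) : EuclideanSpace ℝ (Fin n) →L[ℝ] W :=
  mfderiv (𝓡 n) 𝓘(ℝ, W) F x

/-- `g` is an immersion into the hyperboloid `B(p, p) = -1` with positive definite induced metric. -/
structure IsHyperboloidImmersion (B : L →L[ℝ] L →L[ℝ] ℝ) (g : M → L) : Prop where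
  symm : ∀ p q, B p q = B q p
  nondeg : ∀ p, (∀ q, B p q = 0) → p = 0
  smooth : ContMDiff (𝓡 n) 𝓘(ℝ, L) ∞ g
  form_g : ∀ x, B (g x) (g x) = -1
  pos : ∀ x u, u ≠ 0 → 0 < B (differential n g x u) (differential n g x u)

variable (n) in
/-- The orthogonal projection onto the span of `g x` and of the tangent space at `x`. -/
noncomputable def hullMap (B : L →L[ℝ] L →L[ℝ] ℝ) (g : M → L) (x : M) : L →L[ℝ] L :=
  hullProjection B (g x) (differential n g x)

variable (n) in
/-- The derivative of `F` in the direction of the tangential part of a vector of `L`. -/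
noncomputable def tangentialDeriv (B : L →L[ℝ] L →L[ℝ] ℝ) (g : M → L) (F : M → W) (x : M) :
    L →L[ℝ] W :=
  (differential n F x).comp (tangentialInverse B (differential n g x))

variable (n) in
/-- The second fundamental form as a map on ambient vectors. -/
noncomputable def shapeMap (B : L →L[ℝ] L →L[ℝ] ℝ) (g : M → L) (x : M) : L →L[ℝ] L →L[ℝ] L :=
  tangentialDeriv n B g (hullMap n B g) x

open Classical in
variable (n) in
/-- The orthogonal projection onto the complement of the relative nullity in the tangent space. -/
noncomputable def conullityMap (B : L →L[ℝ] L →L[ℝ] ℝ) (g : M → L) (x : M) : L →L[ℝ] L :=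
  if h : ∃ R, IsOrthogonalProjectionAlong B (shapeMap n B g x) R then h.choose else 0

variable (n) in
/-- The points at which the rank of the second fundamental form is maximal. -/
def maxRankSet (B : L →L[ℝ] L →L[ℝ] ℝ) (g : M → L) : Set M :=
  {x | ∀ y, clmRank (shapeMap n B g y) ≤ clmRank (shapeMap n B g x)}

section ChartTransfer

variable [IsManifold (𝓡 n) ∞ M] (x₀ : M)

theorem contMDiffAt_extChartAt_symm {z : EuclideanSpace ℝ (Fin n)}
    (hz : z ∈ (extChartAt (𝓡 n) x₀).target) :
    ContMDiffAt 𝓘(ℝ, EuclideanSpace ℝ (Fin n)) (𝓡 n) ∞ (extChartAt (𝓡 n) x₀).symm z :=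
  (contMDiffOn_extChartAt_symm x₀).contMDiffAt ((isOpen_extChartAt_target x₀).mem_nhds hz)

theorem exists_fderiv_chart {z : EuclideanSpace ℝ (Fin n)}
    (hz : z ∈ (extChartAt (𝓡 n) x₀).target) :
    ∃ e : EuclideanSpace ℝ (Fin n) ≃L[ℝ] EuclideanSpace ℝ (Fin n),
      (e : EuclideanSpace ℝ (Fin n) →L[ℝ] EuclideanSpace ℝ (Fin n)) =
        mfderiv 𝓘(ℝ, EuclideanSpace ℝ (Fin n)) (𝓡 n) (extChartAt (𝓡 n) x₀).symm z := by
  have : IsManifold (𝓡 n) 1 M := IsManifold.of_le (n := ∞) (by norm_cast)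
  have h := isInvertible_mfderivWithin_extChartAt_symm (I := 𝓡 n) hz
  rw [ModelWithCorners.range_eq_univ, mfderivWithin_univ] at h
  exact h

theorem fderiv_comp_chart {F : M → W} {z : EuclideanSpace ℝ (Fin n)}
    (hz : z ∈ (extChartAt (𝓡 n) x₀).target)
    (hF : MDifferentiableAt (𝓡 n) 𝓘(ℝ, W) F ((extChartAt (𝓡 n) x₀).symm z)) :
    fderiv ℝ (F ∘ (extChartAt (𝓡 n) x₀).symm) z =
      (differential n F ((extChartAt (𝓡 n) x₀).symm z)).comp
        (exists_fderiv_chart x₀ hz).choose.toContinuousLinearMap := by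
  rw [(exists_fderiv_chart x₀ hz).choose_spec, ← mfderiv_eq_fderiv]
  exact mfderiv_comp z hF ((contMDiffAt_extChartAt_symm x₀ hz).mdifferentiableAt (by simp))

theorem contDiffAt_comp_chart {F : M → W} {z : EuclideanSpace ℝ (Fin n)}
    (hz : z ∈ (extChartAt (𝓡 n) x₀).target)
    (hF : ContMDiffAt (𝓡 n) 𝓘(ℝ, W) ∞ F ((extChartAt (𝓡 n) x₀).symm z)) :
    ContDiffAt ℝ ∞ (F ∘ (extChartAt (𝓡 n) x₀).symm) z :=
  contMDiffAt_iff_contDiffAt.1 (hF.comp z (contMDiffAt_extChartAt_symm x₀ hz))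

omit [IsManifold (𝓡 n) ∞ M] in
theorem contMDiffAt_of_chart {F : M → W}
    (hF : ContDiffAt ℝ ∞ (F ∘ (extChartAt (𝓡 n) x₀).symm) (extChartAt (𝓡 n) x₀ x₀)) :
    ContMDiffAt (𝓡 n) 𝓘(ℝ, W) ∞ F x₀ := by
  have h := hF.contMDiffAt.comp x₀ (contMDiffAt_extChartAt (I := 𝓡 n) (n := ∞) (x := x₀))
  refine h.congr_of_eventuallyEq ?_
  filter_upwards [extChartAt_source_mem_nhds (I := 𝓡 n) x₀] with y hy
  exact congrArg F ((extChartAt (𝓡 n) x₀).left_inv hy).symm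

end ChartTransfer

namespace IsHyperboloidImmersion

variable [IsManifold (𝓡 n) ∞ M] {B : L →L[ℝ] L →L[ℝ] ℝ} {g : M → L}
  (H : IsHyperboloidImmersion (n := n) B g)
include H

theorem contDiffAt_chart (x₀ : M) {z : EuclideanSpace ℝ (Fin n)}
    (hz : z ∈ (extChartAt (𝓡 n) x₀).target) :
    ContDiffAt ℝ ∞ (g ∘ (extChartAt (𝓡 n) x₀).symm) z :=
  contDiffAt_comp_chart x₀ hz (H.smooth _)

theorem fderiv_chart (x₀ : M) {z : EuclideanSpace ℝ (Fin n)}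
    (hz : z ∈ (extChartAt (𝓡 n) x₀).target) :
    fderiv ℝ (g ∘ (extChartAt (𝓡 n) x₀).symm) z =
      (differential n g ((extChartAt (𝓡 n) x₀).symm z)).comp
        (exists_fderiv_chart x₀ hz).choose.toContinuousLinearMap :=
  fderiv_comp_chart x₀ hz ((H.smooth _).mdifferentiableAt (by simp))

theorem pos_chart (x₀ : M) {z : EuclideanSpace ℝ (Fin n)}
    (hz : z ∈ (extChartAt (𝓡 n) x₀).target) (u : EuclideanSpace ℝ (Fin n)) (hu : u ≠ 0) :
    0 < B (fderiv ℝ (g ∘ (extChartAt (𝓡 n) x₀).symm) z u)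
      (fderiv ℝ (g ∘ (extChartAt (𝓡 n) x₀).symm) z u) := by
  rw [H.fderiv_chart x₀ hz]
  exact H.pos _ _ (by simpa using hu)

/-- The frame change caused by the chart enters the derivative of F and the inverse of dg in
opposite ways, and cancels. -/
theorem tangentialDeriv_chart (x₀ : M) {F : M → W} {z : EuclideanSpace ℝ (Fin n)}
    (hz : z ∈ (extChartAt (𝓡 n) x₀).target)
    (hF : MDifferentiableAt (𝓡 n) 𝓘(ℝ, W) F ((extChartAt (𝓡 n) x₀).symm z)) :
    tangentialDeriv n B g F ((extChartAt (𝓡 n) x₀).symm z) =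
      (fderiv ℝ (F ∘ (extChartAt (𝓡 n) x₀).symm) z).comp
        (tangentialInverse B (fderiv ℝ (g ∘ (extChartAt (𝓡 n) x₀).symm) z)) := by
  ext w
  rw [fderiv_comp_chart x₀ hz hF, H.fderiv_chart x₀ hz]
  simp only [ContinuousLinearMap.comp_apply]
  rw [tangentialInverse_comp (H.pos _)]
  simp [tangentialDeriv]

theorem hullMap_chart (x₀ : M) {z : EuclideanSpace ℝ (Fin n)}
    (hz : z ∈ (extChartAt (𝓡 n) x₀).target) :
    hullMap n B g ((extChartAt (𝓡 n) x₀).symm z) =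
      hullProjection B ((g ∘ (extChartAt (𝓡 n) x₀).symm) z)
        (fderiv ℝ (g ∘ (extChartAt (𝓡 n) x₀).symm) z) := by
  rw [H.fderiv_chart x₀ hz, hullProjection_comp (H.pos _)]
  rfl

theorem contDiffAt_tangentialInverse_chart (x₀ : M) {z : EuclideanSpace ℝ (Fin n)}
    (hz : z ∈ (extChartAt (𝓡 n) x₀).target) :
    ContDiffAt ℝ ∞ (fun z => tangentialInverse B
      (fderiv ℝ (g ∘ (extChartAt (𝓡 n) x₀).symm) z)) z :=
  (contDiffAt_tangentialInverse (H.pos_chart x₀ hz)).comp z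
    ((H.contDiffAt_chart x₀ hz).fderiv_right (m := ∞) (by norm_cast))

theorem smooth_hullMap : ContMDiff (𝓡 n) 𝓘(ℝ, L →L[ℝ] L) ∞ (hullMap n B g) := by
  intro x
  refine contMDiffAt_of_chart x ?_
  set ĝ := g ∘ (extChartAt (𝓡 n) x).symm
  have hz := mem_extChartAt_target (I := 𝓡 n) x
  have hg := H.contDiffAt_chart x hz
  have h1 : ContDiffAt ℝ ∞ (fun z => (fderiv ℝ ĝ z).comp (tangentialInverse B (fderiv ℝ ĝ z))
      - (B.flip (ĝ z)).smulRight (ĝ z)) (extChartAt (𝓡 n) x x) := by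
    refine ContDiffAt.sub (((hg.fderiv_right (m := ∞) (by norm_cast))).clm_comp
      (H.contDiffAt_tangentialInverse_chart x hz)) ?_
    exact ContDiffAt.smulRight (B.flip.contDiff.contDiffAt.comp _ hg) hg
  refine h1.congr_of_eventuallyEq ?_
  filter_upwards [(isOpen_extChartAt_target x).mem_nhds hz] with z hz
  exact H.hullMap_chart x hz

theorem contMDiffAt_tangentialDeriv {F : M → W} {x : M}
    (hF : ∀ᶠ y in nhds x, ContMDiffAt (𝓡 n) 𝓘(ℝ, W) ∞ F y) :
    ContMDiffAt (𝓡 n) 𝓘(ℝ, L →L[ℝ] W) ∞ (tangentialDeriv n B g F) x := by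
  refine contMDiffAt_of_chart x ?_
  have hz := mem_extChartAt_target (I := 𝓡 n) x
  have hF' := contDiffAt_comp_chart (F := F) x hz
    (by rw [extChartAt_to_inv]; exact hF.self_of_nhds)
  refine ((hF'.fderiv_right (m := ∞) (by norm_cast)).clm_comp
    (H.contDiffAt_tangentialInverse_chart x hz)).congr_of_eventuallyEq ?_
  have hc : ContinuousAt (extChartAt (𝓡 n) x).symm (extChartAt (𝓡 n) x x) :=
    continuousAt_extChartAt_symm x
  have h2 := hc.eventually (p := fun y => ContMDiffAt (𝓡 n) 𝓘(ℝ, W) ∞ F y)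
    (by rw [extChartAt_to_inv]; exact hF)
  filter_upwards [(isOpen_extChartAt_target x).mem_nhds hz, h2] with z hz hFz
  exact H.tangentialDeriv_chart x hz (hFz.mdifferentiableAt (by simp))

theorem smooth_shapeMap : ContMDiff (𝓡 n) 𝓘(ℝ, L →L[ℝ] L →L[ℝ] L) ∞ (shapeMap n B g) :=
  fun _ => H.contMDiffAt_tangentialDeriv (Filter.Eventually.of_forall fun y => H.smooth_hullMap y)

end IsHyperboloidImmersion
end HyperboloidImmersion

/-! ### Smoothness of the conullity projection on the open set of maximal rank. -/

section Conullity

open Set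

variable {n : ℕ} {M : Type*} [TopologicalSpace M] [ChartedSpace (EuclideanSpace ℝ (Fin n)) M]
  {L W : Type*} [NormedAddCommGroup L] [NormedSpace ℝ L]
  [NormedAddCommGroup W] [NormedSpace ℝ W]

namespace IsHyperboloidImmersion

variable [IsManifold (𝓡 n) ∞ M] {B : L →L[ℝ] L →L[ℝ] ℝ} {g : M → L}
  (H : IsHyperboloidImmersion (n := n) B g)
include H

theorem hullChart (x₀ : M) : HullChart B (extChartAt (𝓡 n) x₀).target
    (g ∘ (extChartAt (𝓡 n) x₀).symm) (hullMap n B g ∘ (extChartAt (𝓡 n) x₀).symm)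
    (fun z => tangentialInverse B (fderiv ℝ (g ∘ (extChartAt (𝓡 n) x₀).symm) z)) := by
  have hdg : ∀ z ∈ (extChartAt (𝓡 n) x₀).target, ∀ u,
      B (fderiv ℝ (g ∘ (extChartAt (𝓡 n) x₀).symm) z u)
        ((g ∘ (extChartAt (𝓡 n) x₀).symm) z) = 0 := fun z hz u =>
    form_fderiv_eq_zero H.symm (isOpen_extChartAt_target x₀)
      (fun z hz => (H.contDiffAt_chart x₀ hz).differentiableAt (by simp))
      (fun z _ => H.form_g _) hz u
  exact
  { isOpen := isOpen_extChartAt_target x₀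
    symm := H.symm
    nondeg := H.nondeg
    g_smooth := fun z hz => H.contDiffAt_chart x₀ hz
    G_smooth := fun z hz => contDiffAt_comp_chart x₀ hz (H.smooth_hullMap _)
    S_smooth := fun z hz => H.contDiffAt_tangentialInverse_chart x₀ hz
    form_g := fun z _ => H.form_g _
    S_dg := fun z hz u => tangentialInverse_self (H.pos_chart x₀ hz) u
    S_g := fun z hz => tangentialInverse_normal (H.pos_chart x₀ hz) fun u => by
      rw [H.symm, hdg z hz]
    dg_S := fun z hz w => by
      rw [Function.comp_apply (f := hullMap n B g), H.hullMap_chart x₀ hz, hullProjection_apply]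
      abel
    G_idem := fun z hz w => by
      rw [Function.comp_apply (f := hullMap n B g), H.hullMap_chart x₀ hz]
      exact hullProjection_idem H.symm (H.pos_chart x₀ hz) (H.form_g _) (hdg z hz) w
    G_adj := fun z hz p q => by
      rw [Function.comp_apply (f := hullMap n B g), H.hullMap_chart x₀ hz]
      exact hullProjection_adj H.symm (H.pos_chart x₀ hz) _ p q }

variable (x : M)

omit [IsManifold (𝓡 n) ∞ M] in
-- The kernel of the shape map contains everything orthogonal to the tangent space, g included. So w
-- is tangent, and B is positive definite there. This is the definiteness needed by
-- `isInvertible_projectionAlong`.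
theorem form_shape_zero {w : L} (hw : ∀ z, shapeMap n B g x z = 0 → B w z = 0) (h0 : B w w = 0) :
    w = 0 := by
  set d := differential n g x
  have hd := H.pos x
  set r := w - d (tangentialInverse B d w) with hr
  have hSr : ∀ q, tangentialInverse B d (q - d (tangentialInverse B d q)) = 0 := fun q => by
    rw [map_sub, tangentialInverse_self hd, sub_self]
  have hker : ∀ q, B w (q - d (tangentialInverse B d q)) = 0 := fun q =>
    hw _ (by rw [shapeMap, tangentialDeriv, ContinuousLinearMap.comp_apply]
             exact (congrArg _ (hSr q)).trans (map_zero _))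
  have hrd : ∀ z, B r (d z) = 0 := fun z => by
    rw [hr, map_sub, sub_apply, form_tangentialInverse hd, sub_self]
  have hr0 : r = 0 := H.nondeg _ fun q => by
    have h1 : B (d (tangentialInverse B d w)) (q - d (tangentialInverse B d q)) = 0 := by
      rw [H.symm, map_sub, sub_apply, form_tangentialInverse hd, sub_self]
    have h2 : B r (q - d (tangentialInverse B d q)) = 0 := by
      rw [hr, map_sub B, sub_apply, hker, h1, sub_zero]
    rw [map_sub, hrd, sub_zero] at h2
    exact h2
  have hw' : w = d (tangentialInverse B d w) := sub_eq_zero.1 hr0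
  by_contra hne
  have hu : tangentialInverse B d w ≠ 0 := fun h => hne (by rw [hw', h, map_zero])
  have := hd _ hu
  rw [← hw', h0] at this
  exact lt_irrefl _ this

variable [FiniteDimensional ℝ L] {x}

/-- Composing with a fixed Λ preserves the kernel of the shape map near a point of maximal rank, and
makes the target finite-dimensional with surjective maps. The projection is then given by a formula,
from which openness and smoothness follow. -/
theorem exists_conullityMap_near (hx : x ∈ maxRankSet n B g) :
    ∃ (k : ℕ) (Λ : (L →L[ℝ] L) →L[ℝ] (Fin k → ℝ)),
      ∀ᶠ y in nhds x, y ∈ maxRankSet n B g ∧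
        ((Λ.comp (shapeMap n B g y)).comp (formSharp B (Λ.comp (shapeMap n B g y)))).IsInvertible ∧
        IsOrthogonalProjectionAlong B (shapeMap n B g y) (conullityMap n B g y) ∧
        conullityMap n B g y = projectionAlong B (Λ.comp (shapeMap n B g y)) := by
  obtain ⟨Λ, hΛ⟩ := exists_surjective_near (shapeMap n B g x)
  refine ⟨_, Λ, ?_⟩
  filter_upwards [H.smooth_shapeMap.continuous.continuousAt.eventually hΛ] with y hy
  have hker := ker_eq_of_surjective hy (by rw [Module.finrank_fin_fun]; exact hx y)
  have hinv := isInvertible_projectionAlong H.nondeg hy fun w hw h0 =>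
    H.form_shape_zero y (fun z hz => hw z ((hker z).2 hz)) h0
  have hp := isOrthogonalProjectionAlong H.symm H.nondeg hinv
  have hp' : IsOrthogonalProjectionAlong B (shapeMap n B g y)
      (projectionAlong B (Λ.comp (shapeMap n B g y))) :=
    ⟨hp.idem, hp.adj, fun w => (hp.ker w).trans (hker w)⟩
  have hex : ∃ R, IsOrthogonalProjectionAlong B (shapeMap n B g y) R := ⟨_, hp'⟩
  have hR : IsOrthogonalProjectionAlong B (shapeMap n B g y) (conullityMap n B g y) := by
    rw [conullityMap, dif_pos hex]
    exact hex.choose_spec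
  exact ⟨fun z => (hx z).trans
    (by simpa only [Module.finrank_fin_fun] using le_clmRank_of_surjective hy), hinv, hR, hR.unique H.nondeg hp'⟩

theorem isOpen_maxRankSet : IsOpen (maxRankSet n B g) :=
  isOpen_iff_mem_nhds.2 fun _ hx => by
    obtain ⟨k, Λ, hΛ⟩ := H.exists_conullityMap_near hx
    filter_upwards [hΛ] with y hy using hy.1

theorem conullityMap_spec (hx : x ∈ maxRankSet n B g) :
    IsOrthogonalProjectionAlong B (shapeMap n B g x) (conullityMap n B g x) := by
  obtain ⟨k, Λ, hΛ⟩ := H.exists_conullityMap_near hx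
  exact hΛ.self_of_nhds.2.2.1

theorem smooth_conullityMap (hx : x ∈ maxRankSet n B g) :
    ContMDiffAt (𝓡 n) 𝓘(ℝ, L →L[ℝ] L) ∞ (conullityMap n B g) x := by
  obtain ⟨k, Λ, hΛ⟩ := H.exists_conullityMap_near hx
  have h1 : ContMDiffAt (𝓡 n) 𝓘(ℝ, L →L[ℝ] (Fin k → ℝ)) ∞
      (fun y => Λ.comp (shapeMap n B g y)) x := by
    have h0 : ContDiff ℝ ∞ fun A : L →L[ℝ] L →L[ℝ] L => Λ.comp A :=
      contDiff_const.clm_comp contDiff_id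
    exact h0.contMDiff.contMDiffAt.comp x (H.smooth_shapeMap x)
  have h2 := (contDiffAt_projectionAlong (B := B) hΛ.self_of_nhds.2.1).contMDiffAt.comp x h1
  refine h2.congr_of_eventuallyEq ?_
  filter_upwards [hΛ] with y hy using hy.2.2.2

theorem nullityChart (x₀ : M) : NullityChart B
    ((extChartAt (𝓡 n) x₀).target ∩ (extChartAt (𝓡 n) x₀).symm ⁻¹' maxRankSet n B g)
    (g ∘ (extChartAt (𝓡 n) x₀).symm) (hullMap n B g ∘ (extChartAt (𝓡 n) x₀).symm)
    (conullityMap n B g ∘ (extChartAt (𝓡 n) x₀).symm)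
    (fun z => tangentialInverse B (fderiv ℝ (g ∘ (extChartAt (𝓡 n) x₀).symm) z)) :=
  have h := H.hullChart x₀
  { isOpen := (continuousOn_extChartAt_symm x₀).isOpen_inter_preimage
      (isOpen_extChartAt_target x₀) H.isOpen_maxRankSet
    symm := h.symm
    nondeg := h.nondeg
    g_smooth := fun z hz => h.g_smooth z hz.1
    G_smooth := fun z hz => h.G_smooth z hz.1
    S_smooth := fun z hz => h.S_smooth z hz.1
    form_g := fun z hz => h.form_g z hz.1
    S_dg := fun z hz => h.S_dg z hz.1
    S_g := fun z hz => h.S_g z hz.1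
    dg_S := fun z hz => h.dg_S z hz.1
    G_idem := fun z hz => h.G_idem z hz.1
    G_adj := fun z hz => h.G_adj z hz.1
    R_smooth := fun z hz => contDiffAt_comp_chart x₀ hz.1 (H.smooth_conullityMap hz.2)
    R_idem := fun z hz => (H.conullityMap_spec hz.2).idem
    R_adj := fun z hz => (H.conullityMap_spec hz.2).adj
    R_ker := fun z hz w => by
      have h1 := H.tangentialDeriv_chart x₀ hz.1
        ((H.smooth_hullMap _).mdifferentiableAt (by simp))
      rw [Function.comp_apply (f := conullityMap n B g), (H.conullityMap_spec hz.2).ker, shapeMap,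
        h1]
      rfl }

end IsHyperboloidImmersion
end Conullity

/-! ### Leaves of the relative nullity on the manifold; closedness and continuation. -/

section Leaves

open Set Filter Topology

variable {n : ℕ} {M : Type*} [TopologicalSpace M] [ChartedSpace (EuclideanSpace ℝ (Fin n)) M]
  {L W : Type*} [NormedAddCommGroup L] [NormedSpace ℝ L]
  [NormedAddCommGroup W] [NormedSpace ℝ W]

theorem differential_eq_fderiv {F : M → W} {x : M} (hF : MDifferentiableAt (𝓡 n) 𝓘(ℝ, W) F x) :
    differential n F x =
      fderiv ℝ (F ∘ (extChartAt (𝓡 n) x).symm) (extChartAt (𝓡 n) x x) := by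
  rw [differential, hF.mfderiv, ModelWithCorners.range_eq_univ, fderivWithin_univ]
  rfl

theorem tendsto_clm_apply {ι : Type*} {l : Filter ι} {T : ι → L →L[ℝ] W} {T₀ : L →L[ℝ] W}
    {w : ι → L} {w₀ : L} (hT : Tendsto T l (𝓝 T₀)) (hw : Tendsto w l (𝓝 w₀)) :
    Tendsto (fun k => T k (w k)) l (𝓝 (T₀ w₀)) :=
  (isBoundedBilinearMap_apply.continuous.tendsto (T₀, w₀)).comp (hT.prodMk_nhds hw)

theorem mfderiv_apply_one {F : ℝ → W} {d : W} {t : ℝ} (h : HasDerivAt F d t) :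
    (mfderiv 𝓘(ℝ, ℝ) 𝓘(ℝ, W) F t : ℝ →L[ℝ] W) 1 = d := by
  rw [mfderiv_eq_fderiv, h.hasFDerivAt.fderiv]
  exact one_smul ℝ d

variable (n) in
/-- The derivative of the projection onto the conullity, which encodes the splitting tensor of the
relative nullity. -/
noncomputable def splittingMap (B : L →L[ℝ] L →L[ℝ] ℝ) (g : M → L) (x : M) :
    L →L[ℝ] L →L[ℝ] L :=
  tangentialDeriv n B g (conullityMap n B g) x

variable (n) in
/-- The value at `y` of the Jacobi field along a leaf of the relative nullity with initial value
`h` at `x`. -/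
noncomputable def leafJacobi (B : L →L[ℝ] L →L[ℝ] ℝ) (g : M → L) (x y : M) (h : L) : L :=
  -splittingMap n B g x h (g y)

variable (n) in
/-- The relation between the extrinsic data at two points of a leaf of the relative nullity. -/
structure SameLeaf (B : L →L[ℝ] L →L[ℝ] ℝ) (g : M → L) (x y : M) : Prop where
  hull : hullMap n B g y = hullMap n B g x
  conullity : conullityMap n B g y = conullityMap n B g x
  splitting : ∀ h, conullityMap n B g x h = h →
    splittingMap n B g y (leafJacobi n B g x y h) = splittingMap n B g x h
  shape : ∀ h, conullityMap n B g x h = h →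
    shapeMap n B g y (leafJacobi n B g x y h) = shapeMap n B g x h

namespace IsHyperboloidImmersion

variable [IsManifold (𝓡 n) ∞ M] {B : L →L[ℝ] L →L[ℝ] ℝ} {g : M → L}
  (H : IsHyperboloidImmersion (n := n) B g)
include H

section Pointwise

variable (x : M)

omit [IsManifold (𝓡 n) ∞ M] in
theorem fderiv_eq_differential :
    fderiv ℝ (g ∘ (extChartAt (𝓡 n) x).symm) (extChartAt (𝓡 n) x x) = differential n g x :=
  (differential_eq_fderiv ((H.smooth x).mdifferentiableAt (by simp))).symm

theorem fderiv_hull_eq_differential :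
    fderiv ℝ (hullMap n B g ∘ (extChartAt (𝓡 n) x).symm) (extChartAt (𝓡 n) x x) =
      differential n (hullMap n B g) x :=
  (differential_eq_fderiv ((H.smooth_hullMap x).mdifferentiableAt (by simp))).symm

theorem form_differential (u : EuclideanSpace ℝ (Fin n)) : B (differential n g x u) (g x) = 0 := by
  simpa only [Function.comp_apply, extChartAt_to_inv, H.fderiv_eq_differential] using
    (H.hullChart x).form_dg (mem_extChartAt_target (I := 𝓡 n) x) u

theorem hull_differential (u : EuclideanSpace ℝ (Fin n)) :
    hullMap n B g x (differential n g x u) = differential n g x u := by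
  simpa only [Function.comp_apply, extChartAt_to_inv, H.fderiv_eq_differential] using
    (H.hullChart x).G_dg (mem_extChartAt_target (I := 𝓡 n) x) u

theorem hull_self : hullMap n B g x (g x) = g x := by
  simpa using (H.hullChart x).G_g (mem_extChartAt_target (I := 𝓡 n) x)

omit [IsManifold (𝓡 n) ∞ M] in
theorem shape_differential (u : EuclideanSpace ℝ (Fin n)) :
    shapeMap n B g x (differential n g x u) = differential n (hullMap n B g) x u := by
  simp [shapeMap, tangentialDeriv, tangentialInverse_self (H.pos x)]

theorem differential_hull_comm (u z : EuclideanSpace ℝ (Fin n)) :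
    differential n (hullMap n B g) x u (differential n g x z) =
      differential n (hullMap n B g) x z (differential n g x u) := by
  simpa only [Function.comp_apply, extChartAt_to_inv, H.fderiv_eq_differential,
    H.fderiv_hull_eq_differential] using
    (H.hullChart x).dG_dg_comm (mem_extChartAt_target (I := 𝓡 n) x) u z

theorem differential_hull_eq_zero_iff {u : EuclideanSpace ℝ (Fin n)} :
    differential n (hullMap n B g) x u = 0 ↔
      ∀ z, differential n (hullMap n B g) x u (differential n g x z) = 0 := by
  simpa only [Function.comp_apply, extChartAt_to_inv, H.fderiv_eq_differential,
    H.fderiv_hull_eq_differential] using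
    (H.hullChart x).dG_eq_zero_iff (mem_extChartAt_target (I := 𝓡 n) x) (u := u)

theorem differential_hull_apply (u z : EuclideanSpace ℝ (Fin n)) :
    differential n (hullMap n B g) x u (differential n g x z) =
      fderiv ℝ (fderiv ℝ (g ∘ (extChartAt (𝓡 n) x).symm)) (extChartAt (𝓡 n) x x) u z -
      hullMap n B g x
        (fderiv ℝ (fderiv ℝ (g ∘ (extChartAt (𝓡 n) x).symm)) (extChartAt (𝓡 n) x x) u z) := by
  simpa only [Function.comp_apply, extChartAt_to_inv, H.fderiv_eq_differential,
    H.fderiv_hull_eq_differential] using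
    (H.hullChart x).dG_dg (mem_extChartAt_target (I := 𝓡 n) x) u z

variable [FiniteDimensional ℝ L] {x} (hx : x ∈ maxRankSet n B g)
include hx

omit H [IsManifold (𝓡 n) ∞ M] [FiniteDimensional ℝ L] in
theorem mem_nullityChart : extChartAt (𝓡 n) x x ∈
    (extChartAt (𝓡 n) x).target ∩ (extChartAt (𝓡 n) x).symm ⁻¹' maxRankSet n B g :=
  ⟨mem_extChartAt_target x, by simpa using hx⟩

theorem conullity_self : conullityMap n B g x (g x) = 0 := by
  simpa using (H.nullityChart x).R_g (mem_nullityChart hx)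

theorem exists_conullity_eq (w : L) : ∃ u, differential n g x u = conullityMap n B g x w := by
  have := (H.nullityChart x).dg_S_R (mem_nullityChart hx) w
  rw [H.fderiv_eq_differential] at this
  exact ⟨_, by simpa using this⟩

theorem shape_conullity (w : L) :
    shapeMap n B g x (conullityMap n B g x w) = shapeMap n B g x w := by
  have h := H.conullityMap_spec hx
  rw [← sub_eq_zero, ← map_sub, ← h.ker, map_sub, h.idem, sub_self]

theorem smooth_splittingMap :
    ContMDiffAt (𝓡 n) 𝓘(ℝ, L →L[ℝ] L →L[ℝ] L) ∞ (splittingMap n B g) x :=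
  H.contMDiffAt_tangentialDeriv (by
    filter_upwards [H.isOpen_maxRankSet.mem_nhds hx] with y hy using H.smooth_conullityMap hy)

omit hx in
theorem splittingMap_chart (x₀ : M) {z : EuclideanSpace ℝ (Fin n)}
    (hz : z ∈ (extChartAt (𝓡 n) x₀).target)
    (hU : (extChartAt (𝓡 n) x₀).symm z ∈ maxRankSet n B g) :
    splittingMap n B g ((extChartAt (𝓡 n) x₀).symm z) =
      (fderiv ℝ (conullityMap n B g ∘ (extChartAt (𝓡 n) x₀).symm) z).comp
        (tangentialInverse B (fderiv ℝ (g ∘ (extChartAt (𝓡 n) x₀).symm) z)) :=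
  H.tangentialDeriv_chart x₀ hz ((H.smooth_conullityMap hU).mdifferentiableAt (by simp))

/-- Differentiate R² = R and apply it to a vector of ker R. It makes the Jacobi fields take values
in the conullity. -/
theorem conullity_splitting {b : L} (hb : conullityMap n B g x b = 0) (h : L) :
    conullityMap n B g x (splittingMap n B g x h b) = splittingMap n B g x h b := by
  have hz := mem_nullityChart hx
  have h1 := H.splittingMap_chart x hz.1 hz.2
  have h2 := (H.nullityChart x).dR_tangent hz
    (tangentialInverse B (fderiv ℝ (g ∘ (extChartAt (𝓡 n) x).symm) (extChartAt (𝓡 n) x x)) h) b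
  rw [extChartAt_to_inv] at h1
  simp only [Function.comp_apply, extChartAt_to_inv, hb, map_zero, add_zero] at h2
  rw [h1]
  exact h2.symm

end Pointwise

variable [FiniteDimensional ℝ L] {x : M}

theorem exists_leaf_path (hx : x ∈ maxRankSet n B g) {v : L} (hG : hullMap n B g x v = v)
    (hR : conullityMap n B g x v = 0) (hv : B v v = 1) (hvg : B v (g x) = 0) :
    ∃ ε > (0 : ℝ), ∃ γ : ℝ → M, γ 0 = x ∧ ContMDiffOn 𝓘(ℝ, ℝ) (𝓡 n) 1 γ (Icc 0 ε) ∧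
      ∀ t ∈ Icc 0 ε, γ t ∈ maxRankSet n B g ∧ SameLeaf n B g x (γ t) ∧
        g (γ t) = hypGeodesic (g x) v t ∧
        mfderiv (𝓡 n) 𝓘(ℝ, L) g (γ t) (mfderiv 𝓘(ℝ, ℝ) (𝓡 n) γ t (1 : ℝ)) =
          hypGeodesicVel (g x) v t := by
  have hz := mem_nullityChart hx
  obtain ⟨ε, hε, γ, hγ0, hγC, hγ⟩ := (H.nullityChart x).exists_leaf_curve hz (v := v)
    (by simpa using hG) (by simpa using hR) hv (by simpa using hvg)
  simp only [Function.comp_apply, extChartAt_to_inv] at hγ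
  have hsplit := H.splittingMap_chart x hz.1 hz.2
  have hshape : ∀ z, z ∈ (extChartAt (𝓡 n) x).target →
      shapeMap n B g ((extChartAt (𝓡 n) x).symm z) =
        (fderiv ℝ (hullMap n B g ∘ (extChartAt (𝓡 n) x).symm) z).comp
        (tangentialInverse B (fderiv ℝ (g ∘ (extChartAt (𝓡 n) x).symm) z)) := fun z hz =>
    H.tangentialDeriv_chart x hz ((H.smooth_hullMap _).mdifferentiableAt (by simp))
  have hshape' := hshape _ hz.1
  rw [extChartAt_to_inv] at hsplit hshape'
  refine ⟨ε, hε, fun t => (extChartAt (𝓡 n) x).symm (γ t), by simp [hγ0], ?_, fun t ht => ?_⟩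
  · intro t ht
    exact ((contMDiffAt_extChartAt_symm x (hγ t ht).1.1).of_le (by norm_cast)
      ).comp_contMDiffWithinAt t (hγC t ht).contMDiffWithinAt
  · obtain ⟨htO, htg, htG, htR, ⟨T, hT, hT'⟩, hJ⟩ := hγ t ht
    refine ⟨htO.2, ⟨htG, htR, fun h hh => ?_, fun h hh => ?_⟩, htg, ?_⟩
    · rw [H.splittingMap_chart x htO.1 htO.2, leafJacobi, hsplit]
      exact (hJ h hh).1
    · rw [hshape _ htO.1, leafJacobi, hsplit, hshape']
      exact (hJ h hh).2
    · have hγt : MDifferentiableAt 𝓘(ℝ, ℝ) (𝓡 n) (fun t => (extChartAt (𝓡 n) x).symm (γ t)) t :=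
        ((contMDiffAt_extChartAt_symm x htO.1).mdifferentiableAt (by simp)).comp t
          hT.differentiableAt.mdifferentiableAt
      have hgt : MDifferentiableAt (𝓡 n) 𝓘(ℝ, L) g ((extChartAt (𝓡 n) x).symm (γ t)) :=
        (H.smooth _).mdifferentiableAt (by simp)
      have h1 := mfderiv_comp_apply t hgt hγt (1 : ℝ)
      rw [← h1, ← hT']
      have h2 := ((H.contDiffAt_chart x htO.1).differentiableAt
        (by simp)).hasFDerivAt.comp_hasDerivAt t hT
      exact mfderiv_apply_one h2

theorem leafJacobi_self (hx : x ∈ maxRankSet n B g) {h : L} (hh : conullityMap n B g x h = h) :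
    leafJacobi n B g x x h = h := by
  have hz := mem_nullityChart hx
  have h1 := H.splittingMap_chart x hz.1 hz.2
  have h2 := (H.nullityChart x).dR_S_g hz (h := h) (by simpa using hh)
  simp only [Function.comp_apply, extChartAt_to_inv] at h1 h2
  rw [leafJacobi, h1, ContinuousLinearMap.comp_apply, h2, neg_neg]

theorem sameLeaf_refl (hx : x ∈ maxRankSet n B g) : SameLeaf n B g x x := by
  exact ⟨rfl, rfl, fun h hh => by rw [H.leafJacobi_self hx hh],
    fun h hh => by rw [H.leafJacobi_self hx hh]⟩

theorem conullity_leafJacobi (hx : x ∈ maxRankSet n B g) {y : M} (hy : y ∈ maxRankSet n B g)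
    (hxy : SameLeaf n B g x y) (h : L) :
    conullityMap n B g x (leafJacobi n B g x y h) = leafJacobi n B g x y h := by
  rw [leafJacobi, map_neg, H.conullity_splitting hx]
  rw [← hxy.conullity, H.conullity_self hy]

theorem sameLeaf_trans (hx : x ∈ maxRankSet n B g) {y z : M} (hy : y ∈ maxRankSet n B g)
    (hxy : SameLeaf n B g x y) (hyz : SameLeaf n B g y z) : SameLeaf n B g x z := by
  -- Cocycle rule: the splitting map at y applied to the Jacobi field is the one at x, so both sides
  -- are that same operator evaluated at g z.
  have hJ : ∀ h, conullityMap n B g x h = h →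
      leafJacobi n B g y z (leafJacobi n B g x y h) = leafJacobi n B g x z h := fun h hh => by
    rw [leafJacobi, hxy.splitting h hh, leafJacobi]
  have hR : ∀ h, conullityMap n B g y (leafJacobi n B g x y h) = leafJacobi n B g x y h :=
    fun h => by rw [hxy.conullity, H.conullity_leafJacobi hx hy hxy]
  refine ⟨hyz.hull.trans hxy.hull, hyz.conullity.trans hxy.conullity, fun h hh => ?_,
    fun h hh => ?_⟩
  · rw [← hJ h hh, hyz.splitting _ (hR h), hxy.splitting h hh]
  · rw [← hJ h hh, hyz.shape _ (hR h), hxy.shape h hh]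

/-- Leaves of the relative nullity on the set of maximal rank are closed. -/
theorem sameLeaf_of_tendsto (hx : x ∈ maxRankSet n B g) {y : ℕ → M} {q : M}
    (hq : Tendsto y atTop (𝓝 q)) (hy : ∀ k, SameLeaf n B g x (y k)) :
    q ∈ maxRankSet n B g ∧ SameLeaf n B g x q := by
  have hJ : ∀ h, Tendsto (fun k => leafJacobi n B g x (y k) h) atTop
      (𝓝 (leafJacobi n B g x q h)) := fun h =>
    (((splittingMap n B g x h).continuous.comp H.smooth.continuous).neg.tendsto q).comp hq
  have hA : ∀ h, conullityMap n B g x h = h →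
      shapeMap n B g q (leafJacobi n B g x q h) = shapeMap n B g x h := fun h hh => by
    have h1 := tendsto_clm_apply ((H.smooth_shapeMap.continuous.tendsto q).comp hq) (hJ h)
    refine tendsto_nhds_unique h1 (tendsto_const_nhds.congr fun k => ?_)
    exact ((hy k).shape h hh).symm
  -- The range of the shape map at q contains the range at x, so the rank does not drop in the
  -- limit. Only g and the shape map have been passed to the limit so far; the conullity and the
  -- splitting map are known to be continuous at q only after this.
  have hqU : q ∈ maxRankSet n B g := fun z => by
    refine (hx z).trans (Submodule.finrank_mono ?_)
    rintro _ ⟨w, rfl⟩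
    refine ⟨leafJacobi n B g x q (conullityMap n B g x w), ?_⟩
    exact (hA _ ((H.conullityMap_spec hx).idem w)).trans (H.shape_conullity hx w)
  refine ⟨hqU, ?_, ?_, fun h hh => ?_, hA⟩
  · refine tendsto_nhds_unique ((H.smooth_hullMap.continuous.tendsto q).comp hq)
      (tendsto_const_nhds.congr fun k => ?_)
    exact (hy k).hull.symm
  · refine tendsto_nhds_unique ((H.smooth_conullityMap hqU).continuousAt.tendsto.comp hq)
      (tendsto_const_nhds.congr fun k => ?_)
    exact (hy k).conullity.symm
  · have h1 := tendsto_clm_apply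
      ((H.smooth_splittingMap hqU).continuousAt.tendsto.comp hq) (hJ h)
    refine tendsto_nhds_unique h1 (tendsto_const_nhds.congr fun k => ?_)
    exact ((hy k).splitting h hh).symm

end IsHyperboloidImmersion

/-- Continuation in a complete metric space of a closed relation between a time parameter and a
point that can always be prolonged with speed at most one. -/
theorem exists_continuation {M : Type*} [EMetricSpace M] [CompleteSpace M] {P : ℝ → M → Prop}
    (hcl : ∀ (t : ℕ → ℝ) (y : ℕ → M) (b : ℝ) (q : M), Tendsto t atTop (𝓝 b) →
      Tendsto y atTop (𝓝 q) → (∀ k, P (t k) (y k)) → P b q)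
    (hext : ∀ t y, P t y → ∃ t' > t, ∃ y', P t' y' ∧ edist y y' ≤ ENNReal.ofReal (t' - t))
    {t₀ : ℝ} {x₀ : M} (h0 : P t₀ x₀) (T : ℝ) : ∃ t ≥ T, ∃ y, P t y := by
  by_contra! hT
  let r : {a : ℝ × M // P a.1 a.2} → {a : ℝ × M // P a.1 a.2} → Prop := fun a a' =>
    a.1.1 ≤ a'.1.1 ∧ edist a.1.2 a'.1.2 ≤ ENNReal.ofReal (a'.1.1 - a.1.1)
  have hbd : ∀ a : {a : ℝ × M // P a.1 a.2}, a.1.1 ≤ T := fun a => by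
    by_contra! h
    exact hT _ h.le _ a.2
  -- Zorn's lemma. Along a chain the point is a 1-Lipschitz function of time, so points whose times
  -- tend to the supremum form a Cauchy sequence, and its limit bounds the chain. A maximal element
  -- contradicts `hext`.
  obtain ⟨m, hm⟩ : ∃ m, ∀ a, r m a → r a m := by
    refine exists_maximal_of_chains_bounded (fun c hc => ?_) (fun {a b c} hab hbc =>
      ⟨hab.1.trans hbc.1, ?_⟩)
    · rcases c.eq_empty_or_nonempty with rfl | ⟨a₀, ha₀⟩
      · exact ⟨⟨(t₀, x₀), h0⟩, by simp⟩
      have hch : ∀ a ∈ c, ∀ b ∈ c, edist a.1.2 b.1.2 ≤ edist a.1.1 b.1.1 := by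
        intro a ha b hb
        rcases eq_or_ne a b with rfl | hab
        · simp
        rcases hc ha hb hab with h | h
        · rw [edist_comm a.1.1, edist_dist, Real.dist_eq, abs_of_nonneg (sub_nonneg.2 h.1)]
          exact h.2
        · rw [edist_comm, edist_dist, Real.dist_eq, abs_of_nonneg (sub_nonneg.2 h.1)]
          exact h.2
      have hbdd : BddAbove ((fun a : {a : ℝ × M // P a.1 a.2} => a.1.1) '' c) :=
        ⟨T, by rintro _ ⟨a, _, rfl⟩; exact hbd a⟩
      obtain ⟨u, -, hu, huc⟩ := exists_seq_tendsto_sSup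
        (⟨_, mem_image_of_mem _ ha₀⟩ : ((fun a : {a : ℝ × M // P a.1 a.2} => a.1.1) '' c).Nonempty)
        hbdd
      set b := sSup ((fun a : {a : ℝ × M // P a.1 a.2} => a.1.1) '' c)
      choose a ha hau using huc
      have hcau : CauchySeq fun k => (a k).1.2 := by
        rw [EMetric.cauchySeq_iff]
        intro ε hε
        obtain ⟨N, hN⟩ := EMetric.cauchySeq_iff.1 hu.cauchySeq ε hε
        refine ⟨N, fun j hj k hk => (hch _ (ha j) _ (ha k)).trans_lt ?_⟩
        have := hN j hj k hk
        rwa [← hau j, ← hau k] at this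
      obtain ⟨q, hq⟩ := cauchySeq_tendsto_of_complete hcau
      have hPq : P b q := hcl u _ b q hu hq fun k => by
        rw [← hau k]; exact (a k).2
      refine ⟨⟨(b, q), hPq⟩, fun a' ha' => ?_⟩
      have hle : a'.1.1 ≤ b := le_csSup hbdd (mem_image_of_mem _ ha')
      refine ⟨hle, ?_⟩
      have h1 : Tendsto (fun k => edist a'.1.2 (a k).1.2) atTop (𝓝 (edist a'.1.2 q)) :=
        tendsto_const_nhds.edist hq
      have h2 : Tendsto (fun k => edist a'.1.1 (u k)) atTop (𝓝 (edist a'.1.1 b)) :=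
        tendsto_const_nhds.edist hu
      have h3 := le_of_tendsto_of_tendsto' h1 h2 fun k => by
        rw [← hau k]; exact hch _ ha' _ (ha k)
      rwa [edist_comm a'.1.1, edist_dist b, Real.dist_eq, abs_of_nonneg (sub_nonneg.2 hle)] at h3
    · refine (edist_triangle _ b.1.2 _).trans ((add_le_add hab.2 hbc.2).trans ?_)
      rw [← ENNReal.ofReal_add (sub_nonneg.2 hab.1) (sub_nonneg.2 hbc.1)]
      exact ENNReal.ofReal_le_ofReal (by linarith)
  obtain ⟨t', ht', y', hP, hd⟩ := hext _ _ m.2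
  have := (hm ⟨(t', y'), hP⟩ ⟨ht'.le, hd⟩).1
  exact absurd this (not_le.2 ht')

end Leaves

/-! ### Completeness of the leaves. -/

section Continuation

open Set Filter Topology

variable {n : ℕ} {M : Type*} [EMetricSpace M] [ChartedSpace (EuclideanSpace ℝ (Fin n)) M]
  {L : Type*} [NormedAddCommGroup L] [NormedSpace ℝ L] [FiniteDimensional ℝ L]
  [IsManifold (𝓡 n) ∞ M]
  [RiemannianBundle (fun x : M => TangentSpace (𝓡 n) x)]
  [IsRiemannianManifold (𝓡 n) M]

omit [IsManifold (𝓡 n) ∞ M] in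
theorem edist_le_of_unit_speed {γ : ℝ → M} {ε : ℝ} (hε : 0 ≤ ε)
    (hγ : ContMDiffOn 𝓘(ℝ, ℝ) (𝓡 n) 1 γ (Icc 0 ε))
    (h : ∀ t ∈ Icc 0 ε, ‖mfderiv 𝓘(ℝ, ℝ) (𝓡 n) γ t (1 : ℝ)‖ = 1) :
    edist (γ 0) (γ ε) ≤ ENNReal.ofReal ε := by
  rw [IsRiemannianManifold.out (I := 𝓡 n) (γ 0) (γ ε)]
  refine (Manifold.riemannianEDist_le_pathELength hγ rfl rfl hε).trans ?_
  rw [Manifold.pathELength_eq_lintegral_mfderiv_Icc]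
  have h1 : ∀ t ∈ Icc 0 ε, ‖mfderiv 𝓘(ℝ, ℝ) (𝓡 n) γ t (1 : ℝ)‖ₑ = 1 := fun t ht => by
    rw [← ofReal_norm, h t ht, ENNReal.ofReal_one]
  exact (MeasureTheory.setLIntegral_congr_fun measurableSet_Icc h1).le.trans (by simp)

namespace IsHyperboloidImmersion

variable {B : L →L[ℝ] L →L[ℝ] ℝ} {g : M → L}
  (H : IsHyperboloidImmersion (n := n) B g)
include H

/-- The hull and the conullity at y are those at x, so the velocity of the geodesic at y is again a
unit nullity direction and the local leaf can be restarted there. -/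
theorem exists_leaf_prolongation
    (hiso : ∀ (x : M) (u : TangentSpace (𝓡 n) x),
      B (mfderiv (𝓡 n) 𝓘(ℝ, L) g x u) (mfderiv (𝓡 n) 𝓘(ℝ, L) g x u) = ‖u‖ ^ 2) {x : M}
    (hx : x ∈ maxRankSet n B g) {v : L} (hG : hullMap n B g x v = v)
    (hR : conullityMap n B g x v = 0) (hv : B v v = 1) (hvg : B v (g x) = 0) {t : ℝ} {y : M}
    (hy : y ∈ maxRankSet n B g) (hxy : SameLeaf n B g x y) (hgy : g y = hypGeodesic (g x) v t) :
    ∃ t' > t, ∃ y', (y' ∈ maxRankSet n B g ∧ SameLeaf n B g x y' ∧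
      g y' = hypGeodesic (g x) v t') ∧ edist y y' ≤ ENNReal.ofReal (t' - t) := by
  have hw := form_hypGeodesicVel H.symm (H.form_g x) hv hvg t
  obtain ⟨ε, hε, γ, hγ0, hγC, hγ⟩ := H.exists_leaf_path hy (v := hypGeodesicVel (g x) v t)
    (by rw [hxy.hull]; simp [hypGeodesicVel, H.hull_self, hG])
    (by rw [hxy.conullity]; simp [hypGeodesicVel, H.conullity_self hx, hR]) hw.1
    (by rw [hgy]; exact hw.2)
  obtain ⟨h1, h2, h3, -⟩ := hγ ε ⟨hε.le, le_rfl⟩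
  refine ⟨t + ε, by linarith, γ ε, ⟨h1, H.sameLeaf_trans hx hy hxy h2, ?_⟩, ?_⟩
  · rw [h3, hgy, hypGeodesic_add]
  · rw [add_sub_cancel_left, ← hγ0]
    refine edist_le_of_unit_speed hε.le hγC fun s hs => ?_
    have h4 := hiso _ (mfderiv 𝓘(ℝ, ℝ) (𝓡 n) γ s (1 : ℝ))
    have h5 := (form_hypGeodesicVel H.symm (H.form_g y) hw.1 (by rw [hgy]; exact hw.2) s).1
    rw [(hγ s hs).2.2.2, h5] at h4
    exact (pow_eq_one_iff_of_nonneg (norm_nonneg _) two_ne_zero).1 h4.symm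

/-- In a complete submanifold, the leaves of the relative nullity through points of maximal rank are
complete. -/
theorem exists_sameLeaf_far [CompleteSpace M]
    (hiso : ∀ (x : M) (u : TangentSpace (𝓡 n) x),
      B (mfderiv (𝓡 n) 𝓘(ℝ, L) g x u) (mfderiv (𝓡 n) 𝓘(ℝ, L) g x u) = ‖u‖ ^ 2) {x : M}
    (hx : x ∈ maxRankSet n B g) {v : L} (hG : hullMap n B g x v = v)
    (hR : conullityMap n B g x v = 0) (hv : B v v = 1) (hvg : B v (g x) = 0) (T : ℝ) :
    ∃ t ≥ T, ∃ y, y ∈ maxRankSet n B g ∧ SameLeaf n B g x y ∧ g y = hypGeodesic (g x) v t := by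
  refine exists_continuation (t₀ := 0) (x₀ := x)
    (P := fun t y => y ∈ maxRankSet n B g ∧ SameLeaf n B g x y ∧ g y = hypGeodesic (g x) v t)
    (fun t y b q ht hy hP => ?_) (fun t y hP => ?_) ⟨hx, H.sameLeaf_refl hx, by simp [hypGeodesic]⟩ T
  · obtain ⟨h1, h2⟩ := H.sameLeaf_of_tendsto hx hy fun k => (hP k).2.1
    refine ⟨h1, h2, tendsto_nhds_unique ((H.smooth.continuous.tendsto q).comp hy) ?_⟩
    have hc : Tendsto (fun k => hypGeodesic (g x) v (t k)) atTop (𝓝 (hypGeodesic (g x) v b)) :=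
      ((hasDerivAt_hypGeodesic (g x) v b).continuousAt.tendsto).comp ht
    exact hc.congr fun k => (hP k).2.2.symm
  · exact H.exists_leaf_prolongation hiso hx hG hR hv hvg hP.1 hP.2.1 hP.2.2

end IsHyperboloidImmersion
end Continuation

/-! ### The dimension count, and decay of the second fundamental form along a leaf. -/

section Decay

variable {n : ℕ} {M : Type*} [TopologicalSpace M] [ChartedSpace (EuclideanSpace ℝ (Fin n)) M]
  {L : Type*} [NormedAddCommGroup L] [NormedSpace ℝ L] [FiniteDimensional ℝ L]

omit [FiniteDimensional ℝ L] in
/-- A family of quadratic forms depending linearly on `k (k + 1) / 2` parameters contains a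
nonnegative multiple of any given one. -/
theorem exists_quadratic_eq_smul {E V : Type*} [AddCommGroup E] [Module ℝ E]
    [FiniteDimensional ℝ E] [AddCommGroup V] [Module ℝ V] [FiniteDimensional ℝ V]
    (Q : V →ₗ[ℝ] E →ₗ[ℝ] E →ₗ[ℝ] ℝ) (γ : E →ₗ[ℝ] E →ₗ[ℝ] ℝ) (hγ : ∃ h, γ h h ≠ 0)
    (hd : Module.finrank ℝ E * (Module.finrank ℝ E + 1) / 2 ≤ Module.finrank ℝ V) :
    ∃ v : V, v ≠ 0 ∧ ∃ c : ℝ, 0 ≤ c ∧ ∀ h, Q v h h = c * γ h h := by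
  set k := Module.finrank ℝ E
  let b := Module.finBasis ℝ E
  -- Coordinates of the symmetric part, indexed by the k (k + 1) / 2 unordered pairs.
  let Ψ : (E →ₗ[ℝ] E →ₗ[ℝ] ℝ) →ₗ[ℝ] (Sym2 (Fin k) → ℝ) :=
    { toFun := fun β s => Sym2.lift ⟨fun i j => β (b i) (b j) + β (b j) (b i),
        fun i j => add_comm _ _⟩ s
      map_add' := fun β β' => by
        ext s
        induction s with | _ i j => simp; ring
      map_smul' := fun c β => by
        ext s
        induction s with | _ i j => simp; ring }
  have hΨ : ∀ β, Ψ β = 0 → ∀ h, β h h = 0 := fun β hβ h => by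
    have h1 : β + β.flip = 0 := by
      refine LinearMap.BilinForm.ext_basis b fun i j => ?_
      have := congrFun hβ s(i, j)
      simpa [Ψ] using this
    have h2 := LinearMap.congr_fun (LinearMap.congr_fun h1 h) h
    simp at h2
    linarith
  -- If the parameters inject, dimensions force a bijection and γ itself is attained (c = 1);
  -- otherwise a kernel vector gives c = 0.
  by_cases hinj : Function.Injective (Ψ.comp Q)
  · have hcard : Module.finrank ℝ (Sym2 (Fin k) → ℝ) = k * (k + 1) / 2 := by
      rw [Module.finrank_fintype_fun_eq_card, Sym2.card, Fintype.card_fin, Nat.choose_two_right,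
        Nat.add_sub_cancel, mul_comm]
    have heq : Module.finrank ℝ V = Module.finrank ℝ (Sym2 (Fin k) → ℝ) :=
      le_antisymm (LinearMap.finrank_le_finrank_of_injective hinj) (hcard ▸ hd)
    obtain ⟨v, hv⟩ := (LinearMap.injective_iff_surjective_of_finrank_eq_finrank heq).1 hinj (Ψ γ)
    have hQ : ∀ h, Q v h h = γ h h := fun h => by
      have := hΨ (Q v - γ) ((map_sub Ψ _ _).trans (sub_eq_zero.2 hv)) h
      simpa [sub_eq_zero] using this
    refine ⟨v, ?_, 1, zero_le_one, fun h => by rw [hQ, one_mul]⟩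
    rintro rfl
    obtain ⟨h, hh⟩ := hγ
    exact hh (by rw [← hQ]; simp)
  · rw [injective_iff_map_eq_zero] at hinj
    push Not at hinj
    obtain ⟨v, hv, hv0⟩ := hinj
    exact ⟨v, hv0, 0, le_rfl, fun h => by rw [hΨ (Q v) hv, zero_mul]⟩

/-- Compactness of the unit sphere of E. The norm of L is auxiliary, and this compares it with the
metric. -/
theorem exists_norm_sq_le (B : L →L[ℝ] L →L[ℝ] ℝ) (E : Submodule ℝ L)
    (hE : ∀ e ∈ E, e ≠ 0 → 0 < B e e) : ∃ C : ℝ, 0 ≤ C ∧ ∀ e ∈ E, ‖e‖ ^ 2 ≤ C * B e e := by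
  have hcont : Continuous fun e : E => B e e :=
    (B.continuous.comp continuous_subtype_val).clm_apply continuous_subtype_val
  have key : ∃ C : ℝ, 0 ≤ C ∧ ∀ e : E, ‖e‖ = 1 → 1 ≤ C * B e e := by
    rcases (Metric.sphere (0 : E) 1).eq_empty_or_nonempty with h | h
    · refine ⟨0, le_rfl, fun e he => ?_⟩
      have : e ∈ Metric.sphere (0 : E) 1 := by simpa using he
      simp [h] at this
    · obtain ⟨e₀, he₀, hmin⟩ := (isCompact_sphere (0 : E) 1).exists_isMinOn h hcont.continuousOn
      have hne : (e₀ : L) ≠ 0 := fun h0 => by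
        have h1 : ‖e₀‖ = 1 := by simpa using he₀
        rw [Subtype.ext (a2 := (0 : E)) h0, norm_zero] at h1
        exact zero_ne_one h1
      have hpos := hE e₀ e₀.2 hne
      refine ⟨(B e₀ e₀)⁻¹, (inv_pos.2 hpos).le, fun e he => ?_⟩
      have h2 : B e₀ e₀ ≤ B e e := hmin (by simpa using he)
      rw [← inv_mul_cancel₀ hpos.ne']
      exact mul_le_mul_of_nonneg_left h2 (inv_pos.2 hpos).le
  obtain ⟨C, hC, hC'⟩ := key
  refine ⟨C, hC, fun e he => ?_⟩
  rcases eq_or_ne e 0 with rfl | hne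
  · simp
  have hn : ‖e‖ ≠ 0 := norm_ne_zero_iff.2 hne
  have h1 := hC' (‖e‖⁻¹ • ⟨e, he⟩) (by
    rw [norm_smul, norm_inv, norm_norm]; exact inv_mul_cancel₀ hn)
  simp only [Submodule.coe_smul, map_smul, smul_apply, smul_eq_mul] at h1
  have h2 : 0 < ‖e‖ ^ 2 := by positivity
  calc ‖e‖ ^ 2 = ‖e‖ ^ 2 * 1 := (mul_one _).symm
    _ ≤ ‖e‖ ^ 2 * (C * (‖e‖⁻¹ * (‖e‖⁻¹ * B e e))) := mul_le_mul_of_nonneg_left h1 h2.le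
    _ = C * B e e := by field_simp

namespace IsHyperboloidImmersion

variable [IsManifold (𝓡 n) ∞ M] {B : L →L[ℝ] L →L[ℝ] ℝ} {g : M → L}
  (H : IsHyperboloidImmersion (n := n) B g)
include H

theorem form_conullity_pos {x : M} (hx : x ∈ maxRankSet n B g) {e : L}
    (he : conullityMap n B g x e = e) (h0 : e ≠ 0) : 0 < B e e := by
  obtain ⟨u, hu⟩ := H.exists_conullity_eq hx e
  rw [he] at hu
  rw [← hu]
  refine H.pos x u ?_
  rintro rfl
  exact h0 (by rw [← hu, map_zero])

theorem form_conullity_le {x : M} (hx : x ∈ maxRankSet n B g) (u : EuclideanSpace ℝ (Fin n)) :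
    B (conullityMap n B g x (differential n g x u)) (conullityMap n B g x (differential n g x u)) ≤
      B (differential n g x u) (differential n g x u) := by
  obtain ⟨u', hu'⟩ := H.exists_conullity_eq hx (differential n g x u)
  have h := H.conullityMap_spec hx
  set z := differential n g x u
  have h1 : 0 ≤ B (z - conullityMap n B g x z) (z - conullityMap n B g x z) := by
    rw [← hu', ← map_sub]
    rcases eq_or_ne (u - u') 0 with h0 | h0
    · simp [h0]
    · exact (H.pos x _ h0).le
  have h2 : B (conullityMap n B g x z) (conullityMap n B g x z) = B (conullityMap n B g x z) z := by
    rw [H.symm, ← h.adj, h.idem]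
  simp only [map_sub, sub_apply, h2, H.symm z (conullityMap n B g x z)] at h1
  linarith

/-- The Jacobi field is linear in g y, and DR[h] takes g x to -h. -/
theorem leafJacobi_eq {x y : M} (hx : x ∈ maxRankSet n B g) {v : L} {t : ℝ}
    (hgy : g y = hypGeodesic (g x) v t) {h : L} (hh : conullityMap n B g x h = h) :
    leafJacobi n B g x y h = Real.cosh t • h - Real.sinh t • splittingMap n B g x h v := by
  have := H.leafJacobi_self hx hh
  rw [leafJacobi] at this ⊢
  rw [hgy, hypGeodesic, map_add, map_smul, map_smul]
  rw [neg_eq_iff_eq_neg] at this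
  rw [this]
  module

/-- Decay of the second fundamental form along a geodesic in a leaf of the relative nullity for
whose direction the splitting tensor has a symmetric part that is a multiple of the identity. -/
theorem exists_shape_decay {x : M} (hx : x ∈ maxRankSet n B g) {v : L}
    {c : ℝ} (hc : 0 ≤ c) (hsplit : ∀ h, conullityMap n B g x h = h →
      B (-splittingMap n B g x h v) h = c * B h h) :
    ∃ K : ℝ, ∀ t ≥ 0, ∀ y ∈ maxRankSet n B g, SameLeaf n B g x y →
      g y = hypGeodesic (g x) v t → ∀ u u' : EuclideanSpace ℝ (Fin n),
      B (differential n g y u) (differential n g y u) ≤ 1 →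
      B (differential n g y u') (differential n g y u') ≤ 1 →
      (Real.cosh t * ‖shapeMap n B g y (differential n g y u) (differential n g y u')‖) ^ 2 ≤ K := by
  set R := conullityMap n B g x with hR
  have hRs := H.conullityMap_spec hx
  set E := LinearMap.range (R : L →ₗ[ℝ] L) with hE
  have hmem : ∀ e, e ∈ E ↔ R e = e := fun e =>
    ⟨by rintro ⟨w, rfl⟩; exact hRs.idem w, fun h => ⟨e, h⟩⟩
  obtain ⟨C, hC, hCE⟩ := exists_norm_sq_le B E fun e he h0 =>
    H.form_conullity_pos hx ((hmem e).1 he) h0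
  -- One factor C bounds cosh² t · ‖h‖², the other the conullity part of the second vector.
  refine ⟨‖shapeMap n B g x‖ ^ 2 * C ^ 2, fun t ht y hy hxy hgy u u' hu hu' => ?_⟩
  -- Expanding the square of cosh t · h - sinh t · a, the cross term is 2 c cosh t sinh t B(h, h) ≥
  -- 0 and the last term is nonnegative.
  have hJ : ∀ h, R h = h →
      Real.cosh t ^ 2 * B h h ≤ B (leafJacobi n B g x y h) (leafJacobi n B g x y h) := fun h hh => by
    set a := splittingMap n B g x h v with ha
    have h1 : -B a h = c * B h h := by simpa using hsplit h hh
    have hRa : R (leafJacobi n B g x y h) = leafJacobi n B g x y h :=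
      H.conullity_leafJacobi hx hy hxy h
    have hBh : 0 ≤ B h h := by
      rcases eq_or_ne h 0 with rfl | h0
      · simp
      · exact (H.form_conullity_pos hx hh h0).le
    rw [H.leafJacobi_eq hx hgy hh, ← ha] at hRa ⊢
    have hsa : 0 ≤ B (Real.sinh t • a) (Real.sinh t • a) := by
      have h2 : R (Real.sinh t • a) = Real.sinh t • a := by
        rw [map_sub, map_smul, hh] at hRa
        exact sub_right_injective hRa
      rcases eq_or_ne (Real.sinh t • a) 0 with h0 | h0
      · simp [h0]
      · exact (H.form_conullity_pos hx h2 h0).le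
    have hsh : 0 ≤ Real.sinh t := Real.sinh_nonneg_iff.2 ht
    have hch : 0 ≤ Real.cosh t := (Real.cosh_pos t).le
    simp only [map_sub, sub_apply, map_smul, smul_apply, smul_eq_mul, H.symm h a] at hsa ⊢
    have h3 : 0 ≤ Real.cosh t * Real.sinh t * (c * B h h) := by positivity
    rw [← h1] at h3
    nlinarith
  -- By the expansion `hJ` the Jacobi map is injective on the conullity, hence onto.
  have hex : ∀ e, R e = e → ∃ h, R h = h ∧ leafJacobi n B g x y h = e := by
    let J : E →ₗ[ℝ] E :=
      { toFun := fun h => ⟨leafJacobi n B g x y h,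
          (hmem _).2 (H.conullity_leafJacobi hx hy hxy h)⟩
        map_add' := fun h h' => by ext; simp [leafJacobi]; abel
        map_smul' := fun r h => by ext; simp [leafJacobi] }
    have hinj : Function.Injective J := by
      rw [injective_iff_map_eq_zero]
      intro h h0
      by_contra hne
      have h1 := hJ h ((hmem _).1 h.2)
      have h2 : leafJacobi n B g x y h = 0 := congrArg Subtype.val h0
      have h3 := H.form_conullity_pos hx ((hmem _).1 h.2) (by simpa using hne)
      rw [h2] at h1
      have h4 : 0 < Real.cosh t ^ 2 * B (h : L) h := mul_pos (pow_pos (Real.cosh_pos t) 2) h3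
      simp at h1
      linarith
    intro e he
    obtain ⟨h, hh⟩ := (LinearMap.injective_iff_surjective.1 hinj) ⟨e, (hmem e).2 he⟩
    exact ⟨h, (hmem _).1 h.2, congrArg Subtype.val hh⟩
  have hRy : conullityMap n B g y = R := hxy.conullity
  set z := differential n g y u with hz
  set z' := differential n g y u' with hz'
  obtain ⟨h, hh, hhz⟩ := hex (R z) (hRs.idem z)
  obtain ⟨a, ha⟩ := H.exists_conullity_eq hy z
  obtain ⟨a', ha'⟩ := H.exists_conullity_eq hy z'
  have hsw : ∀ b b', shapeMap n B g y (differential n g y b) (differential n g y b') =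
      shapeMap n B g y (differential n g y b') (differential n g y b) := fun b b' => by
    rw [H.shape_differential, H.shape_differential, H.differential_hull_comm]
  -- By symmetry only the conullity parts of both arguments matter. The first of them is the Jacobi
  -- field of h, so the value is read off at x.
  have hval : shapeMap n B g y z z' = shapeMap n B g x h (R z') := by
    rw [← hxy.shape h hh, hhz, ← hRy, ← ha, ← ha', hsw a a', ha', H.shape_conullity hy, hz',
      hsw u' a, ha, H.shape_conullity hy]
  have hz1 := (H.form_conullity_le hy u).trans hu
  have hz1' := (H.form_conullity_le hy u').trans hu'
  rw [hRy] at hz1 hz1'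
  have hJh := hJ h hh
  rw [hhz] at hJh
  have hn1 := hCE h ((hmem h).2 hh)
  have hn2 := hCE (R z') ((hmem _).2 (hRs.idem z'))
  have hn3 : ‖shapeMap n B g y z z'‖ ≤ ‖shapeMap n B g x‖ * ‖h‖ * ‖R z'‖ := by
    rw [hval]
    exact ((shapeMap n B g x).le_opNorm₂ h (R z'))
  have h5 : Real.cosh t ^ 2 * ‖h‖ ^ 2 ≤ C := by
    calc Real.cosh t ^ 2 * ‖h‖ ^ 2 ≤ Real.cosh t ^ 2 * (C * B h h) :=
          mul_le_mul_of_nonneg_left hn1 (sq_nonneg _)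
      _ = C * (Real.cosh t ^ 2 * B h h) := by ring
      _ ≤ C * 1 := mul_le_mul_of_nonneg_left (hJh.trans hz1) hC
      _ = C := mul_one C
  have h6 : ‖R z'‖ ^ 2 ≤ C := hn2.trans (by
    calc C * B (R z') (R z') ≤ C * 1 := mul_le_mul_of_nonneg_left hz1' hC
      _ = C := mul_one C)
  calc (Real.cosh t * ‖shapeMap n B g y z z'‖) ^ 2
      ≤ (Real.cosh t * (‖shapeMap n B g x‖ * ‖h‖ * ‖R z'‖)) ^ 2 := by
        have := Real.cosh_pos t
        gcongr
    _ = ‖shapeMap n B g x‖ ^ 2 * ((Real.cosh t ^ 2 * ‖h‖ ^ 2) * ‖R z'‖ ^ 2) := by ring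
    _ ≤ ‖shapeMap n B g x‖ ^ 2 * (C * C) := by gcongr
    _ = ‖shapeMap n B g x‖ ^ 2 * C ^ 2 := by ring

end IsHyperboloidImmersion
end Decay

/-! ### Translation between the definitions in Lorentz space and the abstract setting. -/

section Lorentz

/-- The Lorentz form as a continuous bilinear map. -/
noncomputable def lorentzCLM (m : ℕ) : LorentzSpace m →L[ℝ] LorentzSpace m →L[ℝ] ℝ :=
  LinearMap.toContinuousLinearMap
    ((LinearMap.toContinuousLinearMap (𝕜 := ℝ) (E := LorentzSpace m) (F' := ℝ)).toLinearMap.comp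
      (lorentzForm m))

theorem lorentzForm_apply {m : ℕ} (p q : LorentzSpace m) :
    lorentzForm m p q = -(p.1 * q.1) + inner ℝ p.2 q.2 := rfl

theorem lorentzForm_symm {m : ℕ} (p q : LorentzSpace m) :
    lorentzForm m p q = lorentzForm m q p := by
  rw [lorentzForm_apply, lorentzForm_apply, real_inner_comm, mul_comm]

theorem lorentzForm_nondeg {m : ℕ} (p : LorentzSpace m) (h : ∀ q, lorentzForm m p q = 0) :
    p = 0 := by
  have h1 := h (1, 0)
  have h2 := h (0, p.2)
  simp [lorentzForm_apply] at h1 h2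
  exact Prod.ext h1 h2

theorem lorentzForm_self_le {m : ℕ} (p : LorentzSpace m) : lorentzForm m p p ≤ ‖p‖ ^ 2 := by
  rw [lorentzForm_apply, real_inner_self_eq_norm_sq]
  have := pow_le_pow_left₀ (norm_nonneg _) (norm_snd_le p) 2
  nlinarith [mul_self_nonneg p.1]

theorem OrthonormalBasis.form_sum_smul_map {V ι : Type*} [NormedAddCommGroup V]
    [InnerProductSpace ℝ V] [Fintype ι] (e : OrthonormalBasis ι ℝ V) {L : Type*} [AddCommGroup L]
    [Module ℝ L] (B : LinearMap.BilinForm ℝ L) (T : V →ₗ[ℝ] L)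
    (hT : ∀ u v, B (T u) (T v) = inner ℝ u v) (w : L) (z : V) :
    B (T (∑ i, B w (T (e i)) • e i)) (T z) = B w (T z) := by
  rw [hT, sum_inner]
  conv_rhs => rw [← e.sum_repr' z]
  simp only [map_sum, map_smul, real_inner_smul_left, smul_eq_mul]
  exact Finset.sum_congr rfl fun i _ => mul_comm _ _

variable {n m : ℕ} {M : Type*} [EMetricSpace M] [ChartedSpace (EuclideanSpace ℝ (Fin n)) M]
  [RiemannianBundle (fun x : M => TangentSpace (𝓡 n) x)] {f : M → HyperbolicSpace m}

namespace IsIsometricImmersion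

variable (hf : IsIsometricImmersion n f)
include hf

theorem form_mfderiv (x : M) (u v : TangentSpace (𝓡 n) x) :
    lorentzCLM m (differential n (ambientMap f) x u) (differential n (ambientMap f) x v) =
      inner ℝ u v := hf.isometric x u v

theorem isHyperboloidImmersion :
    IsHyperboloidImmersion (n := n) (lorentzCLM m) (ambientMap f) where
  symm := lorentzForm_symm
  nondeg := lorentzForm_nondeg
  smooth := hf.smooth
  form_g x := (f x).2.1
  pos x u hu := by
    have h := hf.form_mfderiv x u u
    rw [h]
    exact real_inner_self_pos.2 hu

variable [IsManifold (𝓡 n) ∞ M]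

/-- Since the position vector is orthogonal to the tangent space, removing its component and then
the tangential one amounts to removing the projection onto their span. -/
theorem normalProjection_tangentProjection (x : M) (w : LorentzSpace m) :
    normalProjection n f x (tangentProjection (f x) w) =
      w - hullMap n (lorentzCLM m) (ambientMap f) x w := by
  have H := hf.isHyperboloidImmersion
  have hp : ∀ u, lorentzForm m (f x).1 (pushforward n f x u) = 0 := fun u =>
    (lorentzForm_symm _ _).trans (H.form_differential x u)
  have h1 : tangentialInverse (lorentzCLM m) (differential n (ambientMap f) x) w =
      (∑ i, lorentzForm m w (pushforward n f x (tangentONB n x i)) • tangentONB n x i :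
        TangentSpace (𝓡 n) x) :=
    tangentialInverse_eq (H.pos x) fun z =>
      (tangentONB n x).form_sum_smul_map (lorentzForm m) (pushforward n f x) (hf.isometric x) w z
  have h2 : hullMap n (lorentzCLM m) (ambientMap f) x w =
      pushforward n f x (∑ i, lorentzForm m w (pushforward n f x (tangentONB n x i)) •
        tangentONB n x i) - lorentzForm m w (f x).1 • (f x).1 := by
    rw [hullMap, hullProjection_apply, h1]
    rfl
  have hflip : ∀ p q : LorentzSpace m, (lorentzForm m).flip p q = lorentzForm m q p :=
    fun _ _ => rfl
  rw [h2, map_sum]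
  simp only [normalProjection, tangentProjection, LinearMap.sub_apply, LinearMap.add_apply,
    LinearMap.id_apply, LinearMap.sum_apply, LinearMap.smulRight_apply, hflip, map_add, map_smul,
    hp, zero_smul, Finset.sum_const_zero, sub_zero]
  abel

theorem secondFundamentalForm_eq (x : M) (u v : EuclideanSpace ℝ (Fin n)) :
    secondFundamentalForm n f x u v =
      shapeMap n (lorentzCLM m) (ambientMap f) x (differential n (ambientMap f) x u)
        (differential n (ambientMap f) x v) := by
  have H := hf.isHyperboloidImmersion
  exact (hf.normalProjection_tangentProjection x _).trans ((H.differential_hull_apply x u v).symm.trans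
    (congrArg (fun A : LorentzSpace m →L[ℝ] LorentzSpace m => A (differential n (ambientMap f) x v))
      (H.shape_differential x u)).symm)

/-- The relative nullity as a subspace of the model space. -/
theorem mem_relativeNullity_iff (x : M) (u : EuclideanSpace ℝ (Fin n)) :
    u ∈ (relativeNullity n f x : Submodule ℝ (EuclideanSpace ℝ (Fin n))) ↔
      differential n (hullMap n (lorentzCLM m) (ambientMap f)) x u = 0 := by
  have H := hf.isHyperboloidImmersion
  refine Iff.trans ?_ (H.differential_hull_eq_zero_iff x (u := u)).symm
  refine LinearMap.ext_iff.trans (forall_congr' fun z => ?_)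
  have h := hf.secondFundamentalForm_eq x u z
  rw [H.shape_differential] at h
  exact Eq.congr_left h

/-- Every tangent vector is the tangential part of an ambient one, so the shape map has the same
range as the derivative of the hull map, whose kernel is the relative nullity. Minimal nullity thus
means maximal rank. -/
theorem nullityIndex_add_rank (x : M) :
    nullityIndex n f x + clmRank (shapeMap n (lorentzCLM m) (ambientMap f) x) = n := by
  have H := hf.isHyperboloidImmersion
  set D : EuclideanSpace ℝ (Fin n) →ₗ[ℝ] LorentzSpace m →L[ℝ] LorentzSpace m :=
    (differential n (hullMap n (lorentzCLM m) (ambientMap f)) x).toLinearMap with hD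
  have hker : (relativeNullity n f x : Submodule ℝ (EuclideanSpace ℝ (Fin n))) =
      LinearMap.ker D := by
    ext u
    exact hf.mem_relativeNullity_iff x u
  have hrange : LinearMap.range (shapeMap n (lorentzCLM m) (ambientMap f) x).toLinearMap =
      LinearMap.range D := by
    ext T
    constructor
    · rintro ⟨w, rfl⟩
      exact ⟨_, rfl⟩
    · rintro ⟨u, rfl⟩
      exact ⟨_, H.shape_differential x u⟩
  have h2 := LinearMap.finrank_range_add_finrank_ker D
  rw [finrank_euclideanSpace_fin, ← hrange, ← hker, add_comm] at h2
  exact h2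

end IsIsometricImmersion

end Lorentz

/-! ### A nullity direction whose splitting tensor has scalar symmetric part. -/

section Umbilic

variable {n : ℕ} {M : Type*} [TopologicalSpace M] [ChartedSpace (EuclideanSpace ℝ (Fin n)) M]
  {L : Type*} [NormedAddCommGroup L] [NormedSpace ℝ L] [FiniteDimensional ℝ L]
  [IsManifold (𝓡 n) ∞ M] {B : L →L[ℝ] L →L[ℝ] ℝ} {g : M → L}

theorem IsOrthogonalProjectionAlong.finrank_range {W : Type*} [NormedAddCommGroup W]
    [NormedSpace ℝ W] {K : L →L[ℝ] W} {R : L →L[ℝ] L} (h : IsOrthogonalProjectionAlong B K R) :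
    Module.finrank ℝ (LinearMap.range R.toLinearMap) = clmRank K := by
  have hk : LinearMap.ker R.toLinearMap = LinearMap.ker K.toLinearMap := by
    ext w
    exact h.ker w
  have h1 := LinearMap.finrank_range_add_finrank_ker R.toLinearMap
  have h2 := LinearMap.finrank_range_add_finrank_ker K.toLinearMap
  rw [hk] at h1
  exact Nat.add_right_cancel (h1.trans h2.symm)

namespace IsHyperboloidImmersion

variable (H : IsHyperboloidImmersion (n := n) B g)
include H

/-- The dimension count is applied to the conullity, whose dimension is the rank of the shape map,
with γ the induced metric. -/
theorem exists_splitting_symm_eq_smul {x : M} (hx : x ∈ maxRankSet n B g)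
    (h0 : clmRank (shapeMap n B g x) ≠ 0) (V : Submodule ℝ (EuclideanSpace ℝ (Fin n)))
    (hV : clmRank (shapeMap n B g x) * (clmRank (shapeMap n B g x) + 1) / 2 ≤
      Module.finrank ℝ V) :
    ∃ u ∈ V, u ≠ 0 ∧ ∃ c ≥ 0, ∀ h, conullityMap n B g x h = h →
      B (-splittingMap n B g x h (differential n g x u)) h = c * B h h := by
  have hR := H.conullityMap_spec hx
  set E := LinearMap.range (conullityMap n B g x).toLinearMap with hE
  have hE1 : Module.finrank ℝ E = clmRank (shapeMap n B g x) := hR.finrank_range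
  have hmem : ∀ e, e ∈ E ↔ conullityMap n B g x e = e := fun e =>
    ⟨by rintro ⟨w, rfl⟩; exact hR.idem w, fun h => ⟨e, h⟩⟩
  let Q : V →ₗ[ℝ] E →ₗ[ℝ] E →ₗ[ℝ] ℝ :=
    { toFun := fun u => LinearMap.mk₂ ℝ
        (fun h h' => B (-splittingMap n B g x h (differential n g x u)) h')
        (fun a b h => by simp; ring) (fun r a h => by simp) (fun a b h => by simp; ring)
        (fun r a h => by simp)
      map_add' := fun u u' => by ext h h'; simp; ring
      map_smul' := fun r u => by ext h h'; simp }
  let γ : E →ₗ[ℝ] E →ₗ[ℝ] ℝ := LinearMap.mk₂ ℝ (fun h h' => B h h')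
    (fun a b h => by simp) (fun r a h => by simp) (fun a b h => by simp) (fun r a h => by simp)
  have hγ : ∃ h, γ h h ≠ 0 := by
    have : Nontrivial E := Module.nontrivial_of_finrank_pos (R := ℝ) (by omega)
    obtain ⟨h, hh⟩ := exists_ne (0 : E)
    exact ⟨h, (H.form_conullity_pos hx ((hmem h).1 h.2) (by simpa using hh)).ne'⟩
  obtain ⟨u, hu, c, hc, hQ⟩ := exists_quadratic_eq_smul Q γ hγ (by rw [hE1]; exact hV)
  exact ⟨u, u.2, by simpa using hu, c, hc, fun h hh => hQ ⟨h, (hmem h).2 hh⟩⟩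

end IsHyperboloidImmersion

end Umbilic

/-! ### From pointwise bounds to the norm of the second fundamental form. -/

section Decay

variable {n m : ℕ} {M : Type*} [EMetricSpace M] [ChartedSpace (EuclideanSpace ℝ (Fin n)) M]
  [RiemannianBundle (fun x : M => TangentSpace (𝓡 n) x)] {f : M → HyperbolicSpace m}
  [IsManifold (𝓡 n) ∞ M]

namespace IsIsometricImmersion

variable (hf : IsIsometricImmersion n f)
include hf

/-- The second fundamental form is small where all its values on unit vectors are small. -/
theorem secondFundamentalFormNorm_sq_le (x : M) {K : ℝ}
    (hK : ∀ u u' : EuclideanSpace ℝ (Fin n),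
      lorentzCLM m (differential n (ambientMap f) x u) (differential n (ambientMap f) x u) ≤ 1 →
      lorentzCLM m (differential n (ambientMap f) x u') (differential n (ambientMap f) x u') ≤ 1 →
      ‖shapeMap n (lorentzCLM m) (ambientMap f) x (differential n (ambientMap f) x u)
        (differential n (ambientMap f) x u')‖ ^ 2 ≤ K) :
    secondFundamentalFormNorm n f x ^ 2 ≤ n * (n * K) := by
  have hn : Module.finrank ℝ (TangentSpace (𝓡 n) x) = n :=
    finrank_euclideanSpace_fin (𝕜 := ℝ) (n := n)
  have hunit : ∀ i, lorentzCLM m (differential n (ambientMap f) x (tangentONB n x i))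
      (differential n (ambientMap f) x (tangentONB n x i)) ≤ 1 := fun i => by
    refine (hf.isometric x _ _).le.trans ?_
    rw [real_inner_self_eq_norm_sq, (tangentONB n x).norm_eq_one, one_pow]
  have hle : ∀ i j,
      lorentzForm m (secondFundamentalForm n f x (tangentONB n x i) (tangentONB n x j))
        (secondFundamentalForm n f x (tangentONB n x i) (tangentONB n x j)) ≤
      K := fun i j => by
    have h1 := hK _ _ (hunit i) (hunit j)
    have h2 := hf.secondFundamentalForm_eq x (tangentONB n x i) (tangentONB n x j)
    rw [← h2] at h1
    exact (lorentzForm_self_le _).trans h1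
  have hK0 : 0 ≤ K := (sq_nonneg _).trans (hK 0 0 (by simp) (by simp))
  have hsum : ∑ i, ∑ j,
      lorentzForm m (secondFundamentalForm n f x (tangentONB n x i) (tangentONB n x j))
        (secondFundamentalForm n f x (tangentONB n x i) (tangentONB n x j)) ≤
      n * (n * K) := by
    refine (Finset.sum_le_sum fun i _ => Finset.sum_le_sum fun j _ => hle i j).trans ?_
    simp [hn]
  rw [secondFundamentalFormNorm]
  -- Positivity of the Lorentz form on normal vectors is not needed: for a nonpositive sum
  -- `Real.sqrt` returns 0 and the bound is trivial.
  rcases le_total 0 (∑ i, ∑ j,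
      lorentzForm m (secondFundamentalForm n f x (tangentONB n x i) (tangentONB n x j))
        (secondFundamentalForm n f x (tangentONB n x i) (tangentONB n x j))) with h | h
  · rw [Real.sq_sqrt h]
    exact hsum
  · rw [Real.sqrt_eq_zero_of_nonpos h, zero_pow two_ne_zero]
    positivity

end IsIsometricImmersion

end Decay

/-! ### The main theorem. -/

theorem mainTheorem1 {n m : ℕ} {M : Type*} [EMetricSpace M]
    [ChartedSpace (EuclideanSpace ℝ (Fin n)) M] [IsManifold (𝓡 n) ∞ M]
    [RiemannianBundle (fun x : M => TangentSpace (𝓡 n) x)]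
    [IsContMDiffRiemannianBundle (𝓡 n) ∞ (EuclideanSpace ℝ (Fin n))
      (fun x : M => TangentSpace (𝓡 n) x)]
    [IsRiemannianManifold (𝓡 n) M] [CompleteSpace M] [Nonempty M]
    (f : M → HyperbolicSpace m) (hf : IsIsometricImmersion n f)
    (hν : (n - minNullityIndex n f) * (n - minNullityIndex n f + 1) / 2 ≤ minNullityIndex n f) :
    ¬ ExtrinsicGeometryBoundedAwayFromZero n f := by
  rintro ⟨c, hc, hbound⟩
  set B := lorentzCLM m
  set g := ambientMap f
  have H : IsHyperboloidImmersion (n := n) B g := hf.isHyperboloidImmersion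
  obtain ⟨x, hx⟩ : ∃ x, nullityIndex n f x = minNullityIndex n f :=
    Nat.sInf_mem (Set.range_nonempty (nullityIndex n f))
  have hrank : ∀ y, nullityIndex n f y + clmRank (shapeMap n B g y) = n := hf.nullityIndex_add_rank
  have hmax : x ∈ maxRankSet n B g := fun y => by
    have h1 : minNullityIndex n f ≤ nullityIndex n f y := Nat.sInf_le ⟨y, rfl⟩
    have := hrank x
    have := hrank y
    omega
  have hk : n - minNullityIndex n f = clmRank (shapeMap n B g x) := by
    have := hrank x
    omega
  rw [hk, ← hx] at hν
  -- Rank zero at x would mean α = 0 there, against the lower bound.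
  have h0 : clmRank (shapeMap n B g x) ≠ 0 := fun h => by
    have h1 : shapeMap n B g x = 0 := by
      have h2 := Submodule.finrank_eq_zero.1 h
      refine ContinuousLinearMap.ext fun w => ?_
      exact LinearMap.congr_fun (LinearMap.range_eq_bot.1 h2) w
    have h3 := hf.secondFundamentalFormNorm_sq_le x (K := 0) fun u u' _ _ => by
      change ‖shapeMap n B g x _ _‖ ^ 2 ≤ 0
      simp [h1]
    have h4 := hbound x
    simp only [mul_zero] at h3
    nlinarith
  obtain ⟨u, hu, hu0, a, ha, hsplit⟩ :=
    H.exists_splitting_symm_eq_smul hmax h0 (relativeNullity n f x) hν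
  replace hu := (hf.mem_relativeNullity_iff x u).1 hu
  have hpos := H.pos x u hu0
  set r := Real.sqrt (B (differential n g x u) (differential n g x u)) with hr
  have hr0 : 0 < r := Real.sqrt_pos.2 hpos
  have hr2 : r ^ 2 = B (differential n g x u) (differential n g x u) := Real.sq_sqrt hpos.le
  set v := differential n g x (r⁻¹ • u) with hv
  have hv' : v = r⁻¹ • differential n g x u := map_smul _ _ _
  have hDv : differential n (hullMap n B g) x (r⁻¹ • u) = 0 := by
    rw [map_smul]
    exact (congrArg _ hu).trans (smul_zero _)
  have hvv : B v v = 1 := by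
    rw [hv']
    simp only [map_smul, smul_apply, smul_eq_mul, ← hr2]
    field_simp
  have hRv : conullityMap n B g x v = 0 :=
    ((H.conullityMap_spec hmax).ker v).2 ((H.shape_differential x _).trans hDv)
  -- Normalising u to unit length multiplies the coefficient a by r⁻¹, which keeps it nonnegative.
  obtain ⟨K, hK⟩ := H.exists_shape_decay hmax (v := v) (c := r⁻¹ * a) (by positivity)
    fun h hh => by
      have h1 := hsplit h hh
      rw [hv']
      simp only [map_smul, map_neg, neg_apply, smul_apply, smul_eq_mul] at h1 ⊢
      rw [mul_assoc, ← h1]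
      ring
  have hiso : ∀ (x : M) (u : TangentSpace (𝓡 n) x),
      B (mfderiv (𝓡 n) 𝓘(ℝ, LorentzSpace m) g x u) (mfderiv (𝓡 n) 𝓘(ℝ, LorentzSpace m) g x u) =
        ‖u‖ ^ 2 := fun x u => (hf.isometric x u u).trans (real_inner_self_eq_norm_sq u)
  set C := (n : ℝ) * (n * K) with hC
  -- The decay estimate will give c² cosh² t ≤ C. From t ≥ 1 follows cosh² t ≥ t, and t > |C| / c²
  -- then yields a contradiction.
  obtain ⟨t, ht, y, hy, hxy, hgy⟩ := H.exists_sameLeaf_far hiso hmax (H.hull_differential x _) hRv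
    hvv (H.form_differential x _) (max 1 (|C| / c ^ 2 + 1))
  have ht1 : 1 ≤ t := (le_max_left _ _).trans ht
  have htC : |C| / c ^ 2 + 1 ≤ t := (le_max_right _ _).trans ht
  have hcosh : t < Real.cosh t :=
    (Real.self_le_sinh_iff.2 (by linarith)).trans_lt (Real.sinh_lt_cosh t)
  have hcp := Real.cosh_pos t
  have h5 := hf.secondFundamentalFormNorm_sq_le y (K := K / Real.cosh t ^ 2) fun w w' hw hw' => by
    rw [le_div_iff₀' (by positivity), ← mul_pow]
    exact hK t (by linarith) y hy hxy hgy w w' hw hw'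
  have h6 : c ^ 2 ≤ secondFundamentalFormNorm n f y ^ 2 := pow_le_pow_left₀ hc.le (hbound y) 2
  have h7 : (n : ℝ) * (n * (K / Real.cosh t ^ 2)) = C / Real.cosh t ^ 2 := by
    rw [hC]; ring
  have h8 : c ^ 2 ≤ C / Real.cosh t ^ 2 := h6.trans (h5.trans h7.le)
  rw [le_div_iff₀ (by positivity)] at h8
  have h9 : |C| < t * c ^ 2 := by
    rw [← div_lt_iff₀ (by positivity)]
    linarith
  have h10 : t ≤ Real.cosh t ^ 2 := by nlinarith
  have h11 : t * c ^ 2 ≤ c ^ 2 * Real.cosh t ^ 2 := by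
    rw [mul_comm]
    exact mul_le_mul_of_nonneg_left h10 (by positivity)
  exact absurd (h9.trans_le (h11.trans h8)) (not_lt.2 (le_abs_self C))
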